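/- \textbf{Setting.} A CAT(0) cube complex is a simply connected cubical complex all of whose vertex links are flag complexes. In a cube complex $\mathcal Y$, hyperplanes (resp. oriented hyperplanes) are the classes of edges (resp. oriented edges) for the equivalence relation generated by being opposite sides of a square (resp. opposite and oriented in the same direction). $\mathcal Y$ is special if its hyperplanes are 2-sided, do not cross themselves and do not directly self-osculate, and no two hyperplanes inter-osculate. A combinatorial path in a CAT(0) cube complex is geodesic if no two of its edges are dual to the same hyperplane. If $\mathbb W$ is a set of hyperplanes of a CAT(0) cube complex $\mathcal Z$, the restriction quotient $\phi:\mathcal Z\to\mathcal Z(\mathbb W)$ identifies two vertices whenever no hyperplane in $\mathbb W$ separates them; the cubes of $\mathcal Z(\mathbb W)$ are the images of the cubes of $\mathcal Z$. Let $\Gamma$ be a group that is not virtually cyclic, acting properly, cocompactly and essentially on a CAT(0) cube complex $\mathcal Z$, and let $\mathbb W$ be a $\Gamma$-invariant set of hyperplanes of $\mathcal Z$ such that the action of $\Gamma$ on $\mathcal X=\mathcal Z(\mathbb W)$ is proper, cocompact and essential. Let $\overline\Gamma<\Gamma$ be a finite index subgroup whose actions on $\mathcal Z$ and $\mathcal X$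 are co-special, i.e. free and such that $\overline{\mathcal Z}=\overline\Gamma\backslash\mathcal Z$ and $\overline{\mathcal X}=\overline\Gamma\backslash\mathcal X$ are special cube complexes. Fix a vertex $\widetilde o$ of $\mathcal Z$ and put $o=\phi(\widetilde o)$. Let $S_{\mathcal Z}$ and $S_{\mathcal X}$ be the sets of oriented hyperplanes of $\overline{\mathcal Z}$ and $\overline{\mathcal X}$. A path in $\mathcal Z$ (resp. $\mathcal X$) represents the word in $(S_{\mathcal Z})^*$ (resp. $(S_{\mathcal X})^*$) whose letters are the images of the oriented hyperplanes dual to its successive oriented edges. An automaton $(\mathcal G,\pi,I,F)$ over a finite set $S$ is a finite directed graph $\mathcal G=(V,E)$ with a labeling $\pi:E\to S$ and non-empty sets $I,F\subset V$ of initial and final states; the language it parametrizes is the set of words $\pi(e_1)\cdots\pi(e_n)$ represented by the paths $v_0\xrightarrow{e_1}\cdots\xrightarrow{e_n}v_n$ ($n\ge 0$) with $v_0\in I$, $v_n\in F$. It is pruned if every vertex is the final vertex of a path starting in $I$. \textbf{Proposition.} The set $S_{\mathcal X}$ is finite, and there is an injection $S_{\mathcal X}\hookrightarrow S_{\mathcal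 Z}$, determined by sending the label of any oriented edge of $\mathcal X$ to the label of any oriented edge of $\mathcal Z$ that $\phi$ maps onto it; we view $S_{\mathcal X}$ as a subset of $S_{\mathcal Z}$. There is a pruned finite-state automaton $\mathcal A_{\mathcal X}=(\mathcal G_{\mathcal X}=(V_{\mathcal X},E_{\mathcal X}),\pi_{\mathcal X},I_{\mathcal X},V_{\mathcal X})$ over $S_{\mathcal X}$, all of whose states are final, parametrizing a language $L_{\mathcal X}\subset(S_{\mathcal X})^*$ such that: \begin{enumerate} \item There exists $C\ge 1$ such that every $w\in L_{\mathcal X}$ is represented by at most $C$ paths in $\mathcal G_{\mathcal X}$ starting at an initial state. \item Every $w\in L_{\mathcal X}$ is represented by a unique combinatorial geodesic $\gamma_w$ in $\mathcal X$ starting at $o$. Let $\tau_{\mathcal X}(w)$ denote its final vertex. \item The map $\tau_{\mathcal X}:L_{\mathcal X}\to\mathcal X^0$ is a bijection onto the set of vertices of $\mathcal X$. \end{enumerate} Moreover, there exist maps $\Psi:V_{\mathcal X}\to(S_{\mathcal Z}\setminus S_{\mathcal X})^*$ and $\Xi:V_{\mathcal X}\to\overline{\mathcal X}^0$ such that, whenever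 $w\in L_{\mathcal X}$ is represented by a path $\omega=(v_0\xrightarrow{e_1}v_1\cdots\xrightarrow{e_n}v_n)$ in $\mathcal G_{\mathcal X}$ starting at an initial state: \begin{enumerate} \item[(4)] the word $\alpha(\omega)=\Psi(v_0)\pi_{\mathcal X}(e_1)\Psi(v_1)\pi_{\mathcal X}(e_2)\cdots\Psi(v_{n-1})\pi_{\mathcal X}(e_n)\in(S_{\mathcal Z})^*$ (empty if $n=0$) is represented by a unique geodesic in $\mathcal Z$ starting at $\widetilde o$, and the final vertex $\tau_{\mathcal Z}(\alpha(\omega))$ of this geodesic satisfies $\phi(\tau_{\mathcal Z}(\alpha(\omega)))=\tau_{\mathcal X}(w)$; \item[(5)] the path $\gamma_w=(\gamma_0,\dots,\gamma_n)$ in $\mathcal X$ projects to $(\Xi(v_0),\dots,\Xi(v_n))$ in $\overline{\mathcal X}$. \end{enumerate} -/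

import Mathlib

universe u v

/-! ### Square complexes: vertices, oriented edges and squares -/

/-- The combinatorial 2-skeleton of a (not necessarily simply connected) cube complex with vertex
set `V` and set of oriented edges `E`. Edges may be loops and there may be multiple edges. -/
structure SquareComplex (V : Type u) (E : Type v) where
  /-- initial vertex of an oriented edge -/
  src : E → V
  /-- orientation reversal -/
  rev : E → E
  /-- `opp e f`: the oriented edges `e` and `f` are opposite sides of a square, oriented in the
  same direction -/
  opp : E → E → Prop
  /-- `corner e f`: the oriented edges `e` and `f` issue from a common vertex and are the two sides
  of a corner of a square at that vertex -/
  corner : E → E → Prop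

namespace SquareComplex

variable {V : Type u} {E : Type v}

/-- Oriented hyperplanes: classes of oriented edges for the equivalence relation generated by
being opposite in a square. -/
def OrientedHyperplane (Y : SquareComplex V E) : Type v := Quot Y.opp

/-- Hyperplanes: classes of (unoriented) edges for the equivalence relation generated by being
opposite in a square. -/
def Hyperplane (Y : SquareComplex V E) : Type v :=
  Quot (fun e f : E => Y.opp e f ∨ f = Y.rev e)

/-- The oriented hyperplane dual to an oriented edge. -/
def ohyp (Y : SquareComplex V E) (e : E) : Y.OrientedHyperplane := Quot.mk _ e

/-- The hyperplane dual to an edge. -/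
def hyp (Y : SquareComplex V E) (e : E) : Y.Hyperplane := Quot.mk _ e

/-- Two hyperplanes cross if they are dual to the two sides of a corner of some square. -/
def Crosses (Y : SquareComplex V E) (h k : Y.Hyperplane) : Prop :=
  ∃ e f, Y.corner e f ∧ Y.hyp e = h ∧ Y.hyp f = k

/-- Special in the sense of Haglund and Wise. -/
structure IsSpecial (Y : SquareComplex V E) : Prop where
  /-- hyperplanes are 2-sided -/
  two_sided : ∀ e, Y.ohyp e ≠ Y.ohyp (Y.rev e)
  /-- hyperplanes are embedded: no hyperplane crosses itself -/
  embedded : ∀ h, ¬ Y.Crosses h h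
  /-- no hyperplane directly self-osculates -/
  no_self_osculation : ∀ e f, Y.src e = Y.src f → e ≠ f → Y.ohyp e = Y.ohyp f → Y.corner e f
  /-- no two hyperplanes inter-osculate -/
  no_inter_osculation : ∀ e f, Y.src e = Y.src f → Y.Crosses (Y.hyp e) (Y.hyp f) → Y.corner e f

end SquareComplex

/-! ### Cubical complexes -/

/-- A family of finite vertex sets, to be thought of as the vertex sets of the cubes of a cubical
complex with vertex set `V`; the axioms are in `CubeComplex.IsCubical`. -/
structure CubeComplex (V : Type u) where
  cubes : Set (Set V)

namespace CubeComplex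

variable {V : Type u}

/-- A cubical complex: every cube is a copy of the vertex set `{0,1}ⁿ` of the standard `n`-cube, in
such a way that the cubes contained in it are exactly its faces, and two cubes that meet intersect
in a common face. -/
structure IsCubical (Z : CubeComplex V) : Prop where
  vertex : ∀ x : V, {x} ∈ Z.cubes
  cube : ∀ C ∈ Z.cubes, ∃ (n : ℕ) (f : (Fin n → Bool) → V), Function.Injective f ∧
    Set.range f = C ∧ ∀ D ⊆ C, (D ∈ Z.cubes ↔
      ∃ (s : Set (Fin n)) (a : Fin n → Bool), D = f '' {x | ∀ i ∈ s, x i = a i})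
  inter : ∀ C ∈ Z.cubes, ∀ D ∈ Z.cubes, (C ∩ D).Nonempty → C ∩ D ∈ Z.cubes

/-- The 1-skeleton. -/
def graph (Z : CubeComplex V) : SimpleGraph V where
  Adj x y := x ≠ y ∧ {x, y} ∈ Z.cubes
  symm := ⟨fun _ _ h => ⟨h.1.symm, Set.pair_comm _ _ ▸ h.2⟩⟩
  loopless := ⟨fun _ h => h.1 rfl⟩

/-- `a, b, c, d` are the vertices of a square, in cyclic order. -/
def IsSquare (Z : CubeComplex V) (a b c d : V) : Prop :=
  {a, b, c, d} ∈ Z.cubes ∧ a ≠ c ∧ b ≠ d ∧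
    Z.graph.Adj a b ∧ Z.graph.Adj b c ∧ Z.graph.Adj c d ∧ Z.graph.Adj d a

/-- Gromov's link condition: the link of every vertex is a flag complex. -/
def LinksAreFlag (Z : CubeComplex V) : Prop :=
  ∀ (x : V) (T : Finset V), (∀ y ∈ T, Z.graph.Adj x y) →
    (∀ y ∈ T, ∀ y' ∈ T, y ≠ y' → ∃ z, Z.IsSquare y x y' z) →
    ∃ C ∈ Z.cubes, x ∈ C ∧ ∀ y ∈ T, y ∈ C

/-- Elementary homotopies of edge paths (given by their lists of vertices): deleting a backtrack,
and pushing a path across a square. -/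
inductive ElementaryHomotopy (Z : CubeComplex V) : List V → List V → Prop
  | backtrack (p q : List V) (x y : V) (h : Z.graph.Adj x y) :
      ElementaryHomotopy Z (p ++ [x, y, x] ++ q) (p ++ [x] ++ q)
  | square (p q : List V) (a b c d : V) (h : Z.IsSquare a b c d) :
      ElementaryHomotopy Z (p ++ [a, b, c] ++ q) (p ++ [a, d, c] ++ q)

/-- Connected, and every closed edge path is homotopic to a constant path: the (edge path)
fundamental group is trivial. -/
def IsSimplyConnected (Z : CubeComplex V) : Prop :=
  Z.graph.Connected ∧ ∀ (x : V) (p : Z.graph.Walk x x),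
    Relation.EqvGen Z.ElementaryHomotopy p.support [x]

/-- A CAT(0) cube complex: a simply connected cubical complex with flag links. -/
structure IsCAT0 (Z : CubeComplex V) : Prop where
  isCubical : Z.IsCubical
  linksAreFlag : Z.LinksAreFlag
  isSimplyConnected : Z.IsSimplyConnected

/-- The 2-skeleton, with oriented edges the ordered pairs of adjacent vertices. -/
def twoSkeleton (Z : CubeComplex V) : SquareComplex V Z.graph.Dart where
  src d := d.fst
  rev d := d.symm
  opp d d' := Z.IsSquare d.fst d.snd d'.snd d'.fst
  corner d d' := d.fst = d'.fst ∧ ∃ z, Z.IsSquare d.snd d.fst d'.snd z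

/-- The hyperplanes of `Z`. -/
abbrev Hyperplane (Z : CubeComplex V) : Type u := Z.twoSkeleton.Hyperplane

/-- The oriented hyperplanes of `Z`. -/
abbrev OrientedHyperplane (Z : CubeComplex V) : Type u := Z.twoSkeleton.OrientedHyperplane

/-- The hyperplanes dual to the successive edges of a combinatorial path. -/
def crossed (Z : CubeComplex V) {x y : V} (p : Z.graph.Walk x y) : List Z.Hyperplane :=
  p.darts.map Z.twoSkeleton.hyp

/-- A combinatorial path is geodesic if no two of its edges are dual to the same hyperplane. -/
def IsGeodesic (Z : CubeComplex V) {x y : V} (p : Z.graph.Walk x y) : Prop :=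
  (Z.crossed p).Nodup

/-- A hyperplane separates two vertices if every combinatorial path between them has an edge dual
to it. -/
def Separates (Z : CubeComplex V) (h : Z.Hyperplane) (x y : V) : Prop :=
  ∀ p : Z.graph.Walk x y, h ∈ Z.crossed p

/-- The halfspace towards which an oriented hyperplane points: the vertices which the hyperplane
does not separate from the terminal vertex of an oriented edge dual to it. -/
def halfspace (Z : CubeComplex V) (d : Z.graph.Dart) : Set V :=
  {x | ¬ Z.Separates (Z.twoSkeleton.hyp d) d.snd x}

/-! ### Restriction quotients -/

/-- Two vertices are identified if no hyperplane in `W` separates them. -/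
def restrictionSetoid (Z : CubeComplex V) (W : Set Z.Hyperplane) : Setoid V where
  r x y := ∀ h ∈ W, ¬ Z.Separates h x y
  iseqv :=
    { refl := fun x h _ H => by simpa [crossed] using H SimpleGraph.Walk.nil
      symm := fun {x y} H h hW K => H h hW fun p => by
        have := K p.reverse
        simp only [crossed, SimpleGraph.Walk.darts_reverse, List.map_reverse, List.map_map,
          List.mem_reverse, List.mem_map, Function.comp_apply] at this ⊢
        obtain ⟨d, hd, rfl⟩ := this
        exact ⟨d, hd, Quot.sound (Or.inr rfl)⟩
      trans := fun {x y z} H K h hW L => by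
        have h1 := H h hW
        have h2 := K h hW
        simp only [Separates, not_forall] at h1 h2
        obtain ⟨p, hp⟩ := h1
        obtain ⟨q, hq⟩ := h2
        have := L (p.append q)
        simp only [crossed, SimpleGraph.Walk.darts_append, List.map_append, List.mem_append] at this
        exact this.elim hp hq }

/-- The vertices of the restriction quotient `Z(W)`. -/
def RestrictionVertex (Z : CubeComplex V) (W : Set Z.Hyperplane) : Type u :=
  Quotient (Z.restrictionSetoid W)

/-- The projection `φ : Z → Z(W)`, on vertices. -/
def proj (Z : CubeComplex V) (W : Set Z.Hyperplane) (x : V) : Z.RestrictionVertex W :=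
  Quotient.mk _ x

/-- The restriction quotient `Z(W)`: its cubes are the images of the cubes of `Z`, so that an edge
is collapsed exactly when its dual hyperplane does not belong to `W`. -/
def restriction (Z : CubeComplex V) (W : Set Z.Hyperplane) :
    CubeComplex (Z.RestrictionVertex W) where
  cubes := {D | ∃ C ∈ Z.cubes, D = Z.proj W '' C}

/-! ### Group actions -/

/-- The group `G`, acting on the vertices, acts by automorphisms of the complex. -/
class IsCubicalAction (G : Type*) [Group G] [MulAction G V] (Z : CubeComplex V) : Prop where
  image_mem : ∀ (g : G), ∀ C ∈ Z.cubes, (fun x => g • x) '' C ∈ Z.cubes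

section Action

variable {G : Type*} [Group G] [MulAction G V] (Z : CubeComplex V)

instance [IsCubicalAction G Z] (H : Subgroup G) : IsCubicalAction H Z :=
  ⟨fun g C hC => IsCubicalAction.image_mem (g : G) C hC⟩

theorem adj_smul [IsCubicalAction G Z] (g : G) {x y : V} (h : Z.graph.Adj x y) :
    Z.graph.Adj (g • x) (g • y) := by
  refine ⟨fun e => h.1 (MulAction.injective g e), ?_⟩
  have := IsCubicalAction.image_mem g _ h.2
  rwa [Set.image_pair] at this

theorem isSquare_smul [IsCubicalAction G Z] (g : G) {a b c d : V} (h : Z.IsSquare a b c d) :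
    Z.IsSquare (g • a) (g • b) (g • c) (g • d) := by
  obtain ⟨h0, h1, h2, h3, h4, h5, h6⟩ := h
  refine ⟨?_, fun e => h1 (MulAction.injective g e), fun e => h2 (MulAction.injective g e),
    Z.adj_smul g h3, Z.adj_smul g h4, Z.adj_smul g h5, Z.adj_smul g h6⟩
  have := IsCubicalAction.image_mem g _ h0
  simpa only [Set.image_insert_eq, Set.image_singleton] using this

/-- The action on oriented edges. -/
instance [IsCubicalAction G Z] : MulAction G Z.graph.Dart where
  smul g d := ⟨(g • d.fst, g • d.snd), Z.adj_smul g d.adj⟩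
  one_smul d := by
    apply SimpleGraph.Dart.ext
    exact Prod.ext (one_smul G d.fst) (one_smul G d.snd)
  mul_smul g h d := by
    apply SimpleGraph.Dart.ext
    exact Prod.ext (mul_smul g h d.fst) (mul_smul g h d.snd)

/-- The action on hyperplanes. -/
instance [IsCubicalAction G Z] : MulAction G Z.Hyperplane where
  smul g := Quot.map (fun d => g • d) (by
    rintro d d' (h | rfl)
    · exact Or.inl (Z.isSquare_smul g h)
    · exact Or.inr rfl)
  one_smul h := by
    induction h using Quot.ind with
    | _ d => exact congrArg (Quot.mk _) (one_smul G d)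
  mul_smul g k h := by
    induction h using Quot.ind with
    | _ d => exact congrArg (Quot.mk _) (mul_smul g k d)

/-- The set `W` of hyperplanes is invariant under the group `G`. -/
class IsInvariant (G : Type*) [Group G] [MulAction G V] (Z : CubeComplex V) [IsCubicalAction G Z]
    (W : Set Z.Hyperplane) : Prop where
  smul_mem : ∀ (g : G), ∀ h ∈ W, g • h ∈ W

theorem separates_smul [IsCubicalAction G Z] (g : G) {h : Z.Hyperplane} {x y : V}
    (H : Z.Separates h x y) : Z.Separates (g • h) (g • x) (g • y) := by
  have key : ∀ {a b : V} (p : Z.graph.Walk a b), ∃ q : Z.graph.Walk (g⁻¹ • a) (g⁻¹ • b),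
      ∀ k ∈ Z.crossed q, g • k ∈ Z.crossed p := by
    intro a b p
    induction p with
    | nil => exact ⟨SimpleGraph.Walk.nil, by simp [crossed]⟩
    | @cons a b c hab p ih =>
      obtain ⟨q, hq⟩ := ih
      refine ⟨SimpleGraph.Walk.cons (Z.adj_smul g⁻¹ hab) q, fun k hk => ?_⟩
      simp only [crossed, SimpleGraph.Walk.darts_cons, List.map_cons, List.mem_cons] at hk ⊢
      rcases hk with rfl | hk
      · left
        refine congrArg (Quot.mk _) (?_ : g • (g⁻¹ • (⟨(a, b), hab⟩ : Z.graph.Dart)) = _)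
        exact smul_inv_smul g _
      · exact Or.inr (hq k hk)
  intro p
  obtain ⟨q, hq⟩ := key p
  refine hq h ?_
  have := H (q.copy (inv_smul_smul g x) (inv_smul_smul g y))
  simpa [crossed] using this

/-- The action on the vertices of the restriction quotient by an invariant set of hyperplanes. -/
instance [IsCubicalAction G Z] (W : Set Z.Hyperplane) [IsInvariant G Z W] :
    MulAction G (Z.RestrictionVertex W) where
  smul g := Quotient.map (fun x => g • x) (by
    intro x y hxy h hW H
    refine hxy (g⁻¹ • h) (IsInvariant.smul_mem g⁻¹ h hW) ?_
    have := Z.separates_smul g⁻¹ H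
    rwa [inv_smul_smul, inv_smul_smul] at this)
  one_smul x := by
    induction x using Quotient.ind with
    | _ x => exact congrArg (Quotient.mk _) (one_smul G x)
  mul_smul g k x := by
    induction x using Quotient.ind with
    | _ x => exact congrArg (Quotient.mk _) (mul_smul g k x)

instance [IsCubicalAction G Z] (W : Set Z.Hyperplane) [IsInvariant G Z W] :
    IsCubicalAction G (Z.restriction W) where
  image_mem := by
    rintro g _ ⟨C, hC, rfl⟩
    refine ⟨_, IsCubicalAction.image_mem g C hC, ?_⟩
    rw [Set.image_image, Set.image_image]
    rfl

variable (G)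

/-- The action is proper: only finitely many group elements move a given finite set of vertices to
a set meeting it. -/
def IsProper (_Z : CubeComplex V) : Prop :=
  ∀ K : Set V, K.Finite → {g : G | ((fun x => g • x) '' K ∩ K).Nonempty}.Finite

/-- The action is cocompact: there are finitely many orbits of cubes. -/
def IsCocompact : Prop :=
  ∃ F : Set (Set V), F.Finite ∧ ∀ C ∈ Z.cubes, ∃ D ∈ F, ∃ g : G, C = (fun x => g • x) '' D

/-- The action is essential: for every hyperplane and every vertex, each of the two halfspaces
contains points of the orbit of the vertex arbitrarily far from the other halfspace. -/
def IsEssential : Prop :=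
  ∀ (d : Z.graph.Dart) (x : V) (R : ℕ), ∃ g : G, g • x ∈ Z.halfspace d ∧
    ∀ y ∈ Z.halfspace d.symm, R ≤ Z.graph.dist (g • x) y

/-- The 2-skeleton of the quotient complex `G \ Z`: its vertices, oriented edges and squares are
the orbits of those of `Z`. -/
def quotient [IsCubicalAction G Z] :
    SquareComplex (MulAction.orbitRel.Quotient G V)
      (MulAction.orbitRel.Quotient G Z.graph.Dart) where
  src := Quotient.map (fun d => d.fst) (by
    rintro _ d ⟨g, rfl⟩
    exact ⟨g, rfl⟩)
  rev := Quotient.map (fun d => d.symm) (by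
    rintro _ d ⟨g, rfl⟩
    exact ⟨g, rfl⟩)
  opp e e' := ∃ d d' : Z.graph.Dart,
    e = Quotient.mk _ d ∧ e' = Quotient.mk _ d' ∧ Z.twoSkeleton.opp d d'
  corner e e' := ∃ d d' : Z.graph.Dart,
    e = Quotient.mk _ d ∧ e' = Quotient.mk _ d' ∧ Z.twoSkeleton.corner d d'

/-- The action is co-special: it is free, and the quotient complex is special. -/
structure IsCospecial [IsCubicalAction G Z] : Prop where
  free : ∀ (g : G) (x : V), g • x = x → g = 1
  special : (Z.quotient G).IsSpecial

/-- The image in the quotient complex `G \ Z` of a vertex of `Z`. -/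
def vertexOrbit (_Z : CubeComplex V) (x : V) : MulAction.orbitRel.Quotient G V := Quotient.mk _ x

/-- The set of oriented hyperplanes of the quotient complex `G \ Z`. -/
abbrev Labels [IsCubicalAction G Z] : Type u := (Z.quotient G).OrientedHyperplane

/-- The label of an oriented edge of `Z`: the image in `G \ Z` of the oriented hyperplane dual to
the edge. -/
def label [IsCubicalAction G Z] (d : Z.graph.Dart) : Z.Labels G :=
  (Z.quotient G).ohyp (Quotient.mk _ d)

/-- The word represented by a combinatorial path. -/
def word [IsCubicalAction G Z] {x y : V} (p : Z.graph.Walk x y) : List (Z.Labels G) :=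
  p.darts.map (Z.label G)

end Action

/-- For a subgroup `H` of `G`: `s` and `t` are the labels (in the quotients by `H`) of an oriented
edge of `Z(W)` and of an oriented edge of `Z` that projects to it. -/
def Corresponds {G : Type*} [Group G] [MulAction G V] (Z : CubeComplex V)
    [IsCubicalAction G Z] (W : Set Z.Hyperplane) [IsInvariant G Z W] (H : Subgroup G)
    (s : (Z.restriction W).Labels H) (t : Z.Labels H) : Prop :=
  ∃ (d : Z.graph.Dart) (d' : (Z.restriction W).graph.Dart),
    Z.proj W d.fst = d'.fst ∧ Z.proj W d.snd = d'.snd ∧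
      (Z.restriction W).label H d' = s ∧ Z.label H d = t

/-- The combinatorial paths starting at the vertex `x`. -/
abbrev PathsFrom (Z : CubeComplex V) (x : V) : Type u := Σ y : V, Z.graph.Walk x y

end CubeComplex

/-! ### Automata and groups -/

/-- A finite-state automaton over `S`: a finite directed graph with edges labeled by `S`, together
with non-empty sets of initial and of final states. -/
structure FiniteAutomaton (S : Type u) where
  State : Type
  Edge : Type
  finite_state : Finite State
  finite_edge : Finite Edge
  src : Edge → State
  tgt : Edge → State
  label : Edge → S
  initial : Set State
  final : Set State
  initial_nonempty : initial.Nonempty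
  final_nonempty : final.Nonempty

namespace FiniteAutomaton

variable {S : Type u} (A : FiniteAutomaton S)

/-- The list of edges is a directed path with initial vertex the given state. A path is recorded
by its initial vertex and its list of edges; the empty list gives the paths of length 0. -/
def IsPath : A.State → List A.Edge → Prop
  | _, [] => True
  | q, e :: es => A.src e = q ∧ IsPath (A.tgt e) es

/-- The list of states visited by a path. -/
def states : A.State → List A.Edge → List A.State
  | q, [] => [q]
  | q, e :: es => q :: states (A.tgt e) es

/-- The final vertex of a path. -/
def endState : A.State → List A.Edge → A.State
  | q, [] => q
  | _, e :: es => endState (A.tgt e) es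

/-- The language parametrized by the automaton: the words represented by the paths from an initial
state to a final state. -/
def language : Language S :=
  {w | ∃ q ∈ A.initial, ∃ es, A.IsPath q es ∧ A.endState q es ∈ A.final ∧ es.map A.label = w}

/-- The automaton is pruned: every state is the final vertex of a path starting at an initial
state. -/
def IsPruned : Prop := ∀ q', ∃ q ∈ A.initial, ∃ es, A.IsPath q es ∧ A.endState q es = q'

/-- The paths starting at an initial state that represent the word `w`. -/
def pathsRepresenting (w : List S) : Set (A.State × List A.Edge) :=
  {p | p.1 ∈ A.initial ∧ A.IsPath p.1 p.2 ∧ p.2.map A.label = w}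

/-- The word `Ψ(v₀) π(e₁) Ψ(v₁) π(e₂) ⋯ Ψ(vₙ₋₁) π(eₙ)` associated with the path
`v₀ → v₁ → ⋯ → vₙ` with edges `e₁, …, eₙ`, the letters `π(eᵢ)` being seen in the alphabet `T` by
means of `ι`. -/
def interleave {T : Type u} (ι : S → T) (Ψ : A.State → List T) : A.State → List A.Edge → List T
  | _, [] => []
  | q, e :: es => Ψ q ++ ι (A.label e) :: interleave ι Ψ (A.tgt e) es

end FiniteAutomaton

/-- The group has a cyclic subgroup of finite index. -/
def IsVirtuallyCyclic (G : Type*) [Group G] : Prop :=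
  ∃ H : Subgroup G, IsCyclic H ∧ H.FiniteIndex

/-!
Write `X` for the restriction quotient `Z(W)` and `φ` for the projection `Z → X`.

**Walls.** Simple connectedness is used once: the parity of the number of crossings of a hyperplane
is a homotopy invariant of edge paths (`IsSimplyConnected.exists_side`), so every hyperplane of `Z`
has two sides. The theory of geodesics then follows from specialness alone. Two edges at a vertex
whose hyperplanes cross anywhere span a square there, and a vertex has at most one edge with a given
label. If a geodesic is preceded by an edge dual to a hyperplane `h` that it crosses, the
hyperplanes crossed in between separate two edges dual to `h` and hence cross `h`, so the first edge
can be pushed through squares until it cancels with the second one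
(`IsWallSpace.exists_geodesic_of_mem_crossed`). Hence geodesics exist, and they cross exactly the
hyperplanes that separate their endpoints. These arguments are made for wall spaces
(`IsWallSpace`), because they are needed for `X` too, which inherits its walls from `W`
(`IsWallSpace.exists_restriction_side`) and is never shown to be CAT(0).

**Labels.** Two edges of `Z` over the same edge of `X`, or over opposite sides of a square of `X`,
are dual to the same oriented hyperplane; conversely, opposite sides of a square of `Z` that are not
collapsed lie over the same edge or over opposite sides of a square. This gives the injection of
alphabets (`IsWallSpace.exists_label_map`), whose image is the set of labels of edges dual to `W`.

**Normal forms.** Order the alphabet of `X`. The predecessor of a vertex `y ≠ φ(o)` is reached along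
that edge from `y` towards `φ(o)` whose label is smallest. The words read on the resulting
geodesics form a language in bijection with the vertices. It is regular: when an edge with label `s`
leads away from `φ(o)`, the labels of the edges pointing back from its endpoint are the inverse of
`s` and those labels pointing back before that cross `s` (`IsWallSpace.downLabels_snd`). So the
possible continuations depend only on the orbit of a vertex and on a set of labels.

**Lifting.** Given `z` in `Z` and an edge at `φ(z)`, a shortest path inside the fibre from `z` to a
lift of the edge crosses no hyperplane that crosses the one dual to the edge
(`IsWallSpace.exists_gate`). After the lifted edge has been traversed, the hyperplanes crossed in
the fibre lie behind its hyperplane, which is never crossed again; so the concatenation of these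
paths is geodesic (`IsWallSpace.isShielded_append`). The words of the paths in the fibres can be
chosen to depend only on the orbit of `z` and on the label of the edge (`gateWord`).

**The automaton.** A state records the orbit of a vertex of `Z`, a set of labels pointing back, and
a guess of the next letter, or of the end of the word (`FiniteAutomaton.exists_automaton`). With the
guess, the state determines the word to be inserted before the next letter. The guesses in all
states but the last are forced by the word, which bounds the number of paths representing it.
-/

namespace CubeComplex

variable {V : Type u}

/-! ### Squares and hyperplanes -/

section Squares

variable {Y : CubeComplex V}

theorem IsSquare.rotate {a b c d : V} (h : Y.IsSquare a b c d) : Y.IsSquare b c d a := by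
  obtain ⟨h0, h1, h2, h3, h4, h5, h6⟩ := h
  refine ⟨?_, h2, h1.symm, h4, h5, h6, h3⟩
  convert h0 using 1
  ext x
  simp only [Set.mem_insert_iff, Set.mem_singleton_iff]
  tauto

theorem IsSquare.reflect {a b c d : V} (h : Y.IsSquare a b c d) : Y.IsSquare a d c b := by
  obtain ⟨h0, h1, h2, h3, h4, h5, h6⟩ := h
  refine ⟨?_, h1, h2.symm, h6.symm, h5.symm, h4.symm, h3.symm⟩
  convert h0 using 1
  ext x
  simp only [Set.mem_insert_iff, Set.mem_singleton_iff]
  tauto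

theorem corner_symm {d e : Y.graph.Dart} (h : Y.twoSkeleton.corner d e) :
    Y.twoSkeleton.corner e d := by
  obtain ⟨h1, z, h2⟩ := h
  refine ⟨h1.symm, z, ?_⟩
  rw [← h1]
  exact h2.rotate.rotate.reflect

theorem crosses_symm {h k : Y.Hyperplane} (H : Y.twoSkeleton.Crosses h k) :
    Y.twoSkeleton.Crosses k h := by
  obtain ⟨e, f, h1, h2, h3⟩ := H
  exact ⟨f, e, corner_symm h1, h3, h2⟩

theorem hyp_symm (d : Y.graph.Dart) : Y.twoSkeleton.hyp d.symm = Y.twoSkeleton.hyp d :=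
  (Quot.sound (r := fun e f => Y.twoSkeleton.opp e f ∨ f = Y.twoSkeleton.rev e)
    (Or.inr rfl)).symm

theorem hyp_eq_of_opp {d e : Y.graph.Dart} (h : Y.twoSkeleton.opp d e) :
    Y.twoSkeleton.hyp d = Y.twoSkeleton.hyp e :=
  Quot.sound (Or.inl h)

theorem opp_rev {d e : Y.graph.Dart} (h : Y.twoSkeleton.opp d e) :
    Y.twoSkeleton.opp d.symm e.symm :=
  h.rotate.reflect

/-- Equality of hyperplanes determines the oriented hyperplanes up to reversal. -/
theorem ohyp_eq_or_of_hyp_eq {d e : Y.graph.Dart}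
    (h : Y.twoSkeleton.hyp d = Y.twoSkeleton.hyp e) :
    Y.twoSkeleton.ohyp d = Y.twoSkeleton.ohyp e ∨
      Y.twoSkeleton.ohyp d = Y.twoSkeleton.ohyp e.symm := by
  have rev : ∀ {d e : Y.graph.Dart}, Y.twoSkeleton.ohyp d = Y.twoSkeleton.ohyp e →
      Y.twoSkeleton.ohyp d.symm = Y.twoSkeleton.ohyp e.symm := by
    intro d e H
    have := Quot.eqvGen_exact H
    clear H
    induction this with
    | rel d e h => exact Quot.sound (opp_rev h)
    | refl d => rfl
    | symm d e _ ih => exact ih.symm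
    | trans d e f _ _ ih ih' => exact ih.trans ih'
  have := Quot.eqvGen_exact h
  clear h
  induction this with
  | rel d e h =>
    rcases h with h | rfl
    · exact Or.inl (Quot.sound h)
    · exact Or.inr rfl
  | refl d => exact Or.inl rfl
  | symm d e _ ih =>
    rcases ih with ih | ih
    · exact Or.inl ih.symm
    · exact Or.inr (rev ih).symm
  | trans d e f _ _ ih ih' =>
    rcases ih with ih | ih <;> rcases ih' with ih' | ih'
    · exact Or.inl (ih.trans ih')
    · exact Or.inr (ih.trans ih')
    · exact Or.inr (ih.trans (rev ih'))
    · exact Or.inl (ih.trans (rev ih'))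

end Squares

/-! ### Labels of oriented edges -/

section Labels

variable {G : Type*} [Group G] [MulAction G V] {Y : CubeComplex V} [Y.IsCubicalAction G]

theorem smul_dart_symm (g : G) (d : Y.graph.Dart) : (g • d).symm = g • d.symm := rfl

theorem corner_smul (g : G) {d e : Y.graph.Dart} (h : Y.twoSkeleton.corner d e) :
    Y.twoSkeleton.corner (g • d) (g • e) := by
  obtain ⟨h1, z, h2⟩ := h
  exact ⟨congrArg (g • ·) h1, g • z, Y.isSquare_smul g h2⟩

theorem crosses_smul (g : G) {h k : Y.Hyperplane} (H : Y.twoSkeleton.Crosses h k) :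
    Y.twoSkeleton.Crosses (g • h) (g • k) := by
  obtain ⟨e, f, h1, rfl, rfl⟩ := H
  exact ⟨g • e, g • f, corner_smul g h1, rfl, rfl⟩

theorem label_smul (g : G) (d : Y.graph.Dart) : Y.label G (g • d) = Y.label G d :=
  congrArg (Quot.mk _) (Quotient.sound ⟨g, rfl⟩)

theorem label_eq_of_opp {d e : Y.graph.Dart} (h : Y.twoSkeleton.opp d e) :
    Y.label G d = Y.label G e :=
  Quot.sound ⟨d, e, rfl, rfl, h⟩

theorem label_eq_of_ohyp_eq {d e : Y.graph.Dart}
    (h : Y.twoSkeleton.ohyp d = Y.twoSkeleton.ohyp e) : Y.label G d = Y.label G e := by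
  have := Quot.eqvGen_exact h
  clear h
  induction this with
  | rel d e h => exact label_eq_of_opp h
  | refl d => rfl
  | symm d e _ ih => exact ih.symm
  | trans d e f _ _ ih ih' => exact ih.trans ih'

/-- To extend a function of oriented edges to labels, it suffices that it is invariant under the
group and under moving across a square. -/
theorem apply_eq_of_label_eq {β : Sort*} (F : Y.graph.Dart → β)
    (hG : ∀ (g : G) d, F (g • d) = F d) (hopp : ∀ d e, Y.twoSkeleton.opp d e → F d = F e)
    {d e : Y.graph.Dart} (h : Y.label G d = Y.label G e) : F d = F e := by
  let F' : MulAction.orbitRel.Quotient G Y.graph.Dart → β := Quotient.lift F (by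
    rintro _ d ⟨g, rfl⟩
    exact hG g d)
  have key : ∀ a b, (Y.quotient G).opp a b → F' a = F' b := by
    rintro _ _ ⟨d, e, rfl, rfl, h⟩
    exact hopp d e h
  exact congrArg (Quot.lift F' key) h

theorem quotient_hyp_eq_of_label_eq {d e : Y.graph.Dart} (h : Y.label G d = Y.label G e) :
    (Y.quotient G).hyp (Quotient.mk _ d) = (Y.quotient G).hyp (Quotient.mk _ e) :=
  apply_eq_of_label_eq (fun d => (Y.quotient G).hyp (Quotient.mk _ d))
    (fun g _ => congrArg (Quot.mk _) (Quotient.sound ⟨g, rfl⟩))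
    (fun d e h => Quot.sound (Or.inl ⟨d, e, rfl, rfl, h⟩)) h

theorem quotient_hyp_eq_of_hyp_eq {d e : Y.graph.Dart}
    (h : Y.twoSkeleton.hyp d = Y.twoSkeleton.hyp e) :
    (Y.quotient G).hyp (Quotient.mk _ d) = (Y.quotient G).hyp (Quotient.mk _ e) := by
  refine congrArg (Quot.lift (fun d => (Y.quotient G).hyp (Quotient.mk _ d)) ?_) h
  rintro d e (h | rfl)
  · exact Quot.sound (Or.inl ⟨d, e, rfl, rfl, h⟩)
  · exact Quot.sound (Or.inr rfl)

variable (Y G) in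
/-- Two labels cross if they are the labels of the two sides of a corner of a square. -/
def LabelCrosses (s t : Y.Labels G) : Prop :=
  ∃ d e, Y.twoSkeleton.corner d e ∧ Y.label G d = s ∧ Y.label G e = t

variable (hY : Y.IsCospecial G)

include hY

theorem IsCospecial.dart_eq {d e : Y.graph.Dart} (h : d.fst = e.fst)
    (H : (Quotient.mk _ d : MulAction.orbitRel.Quotient G Y.graph.Dart) = Quotient.mk _ e) :
    d = e := by
  obtain ⟨g, rfl⟩ := Quotient.exact H
  have : g = 1 := hY.free g e.fst h
  subst this
  exact one_smul G e

theorem IsCospecial.corner_of_quotient_corner {d e : Y.graph.Dart} (h : d.fst = e.fst)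
    (H : (Y.quotient G).corner (Quotient.mk _ d) (Quotient.mk _ e)) :
    Y.twoSkeleton.corner d e := by
  obtain ⟨d', e', h1, h2, h3⟩ := H
  obtain ⟨g, rfl⟩ := Quotient.exact h1
  obtain ⟨k, rfl⟩ := Quotient.exact h2
  have hgk : g = k := by
    have h4 : d'.fst = e'.fst := h3.1
    have h5 : g • d'.fst = k • e'.fst := h
    rw [← h4] at h5
    have := hY.free (k⁻¹ * g) d'.fst (by rw [mul_smul, h5, inv_smul_smul])
    rw [inv_mul_eq_one] at this
    exact this.symm
  subst hgk
  exact corner_smul g h3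

theorem IsCospecial.corner_of_quotient_crosses {d e : Y.graph.Dart} (h : d.fst = e.fst)
    (H : (Y.quotient G).Crosses ((Y.quotient G).hyp (Quotient.mk _ d))
      ((Y.quotient G).hyp (Quotient.mk _ e))) : Y.twoSkeleton.corner d e :=
  hY.corner_of_quotient_corner h
    (hY.special.no_inter_osculation _ _ (congrArg (Quotient.mk _) h) H)

theorem IsCospecial.corner_of_labelCrosses {d e : Y.graph.Dart} (h : d.fst = e.fst)
    (H : Y.LabelCrosses G (Y.label G d) (Y.label G e)) : Y.twoSkeleton.corner d e := by
  obtain ⟨d', e', h1, h2, h3⟩ := H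
  exact hY.corner_of_quotient_crosses h ⟨_, _, ⟨d', e', rfl, rfl, h1⟩,
    quotient_hyp_eq_of_label_eq h2, quotient_hyp_eq_of_label_eq h3⟩

theorem IsCospecial.corner_of_crosses {d e : Y.graph.Dart} (h : d.fst = e.fst)
    (H : Y.twoSkeleton.Crosses (Y.twoSkeleton.hyp d) (Y.twoSkeleton.hyp e)) :
    Y.twoSkeleton.corner d e := by
  obtain ⟨d', e', h1, h2, h3⟩ := H
  exact hY.corner_of_quotient_crosses h ⟨_, _, ⟨d', e', rfl, rfl, h1⟩,
    quotient_hyp_eq_of_hyp_eq h2, quotient_hyp_eq_of_hyp_eq h3⟩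

theorem IsCospecial.not_crosses_self (h : Y.Hyperplane) : ¬ Y.twoSkeleton.Crosses h h := by
  rintro ⟨d, e, h1, h2, h3⟩
  exact hY.special.embedded _ ⟨_, _, ⟨d, e, rfl, rfl, h1⟩, rfl,
    (quotient_hyp_eq_of_hyp_eq (h2.trans h3.symm)).symm⟩

/-- An oriented edge is determined by its initial vertex and its label. -/
theorem IsCospecial.eq_of_label_eq {d e : Y.graph.Dart} (h : d.fst = e.fst)
    (H : Y.label G d = Y.label G e) : d = e := by
  by_contra hne
  refine hY.special.embedded _ ⟨_, _, hY.special.no_self_osculation (Quotient.mk _ d)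
    (Quotient.mk _ e) (congrArg (Quotient.mk _) h) (fun h' => hne (hY.dart_eq h h')) H, rfl, ?_⟩
  exact (quotient_hyp_eq_of_label_eq H).symm

/-- A path is determined by its initial vertex and the word it represents. -/
theorem IsCospecial.eq_of_word_eq {x y z : V} (p : Y.graph.Walk x y) (q : Y.graph.Walk x z)
    (h : Y.word G p = Y.word G q) : (⟨y, p⟩ : Y.PathsFrom x) = ⟨z, q⟩ := by
  induction p with
  | nil =>
    cases q with
    | nil => rfl
    | cons hq q => simp [word] at h
  | @cons a b c hab p ih =>
    cases q with
    | nil => simp [word] at h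
    | @cons _ b' _ hab' q =>
      simp only [word, SimpleGraph.Walk.darts_cons, List.map_cons, List.cons.injEq] at h
      have h1 := hY.eq_of_label_eq (d := ⟨(a, b), hab⟩) (e := ⟨(a, b'), hab'⟩) rfl h.1
      have h2 : b = b' := congrArg (fun d => d.snd) h1
      subst h2
      have h3 := ih q h.2
      obtain ⟨rfl, h4⟩ := Sigma.mk.inj_iff.mp h3
      cases h4
      rfl

end Labels

/-! ### Wall spaces -/

/-- The properties of a CAT(0) cube complex on which the arguments rest, in a form that can be
checked for a restriction quotient without knowing that it is CAT(0): the complex is connected,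
`side h` is the indicator function of one of the halfspaces of the hyperplane `h`, and the
hyperplanes dual to the edges at a given vertex are distinct and cross only when they span a square
at that vertex. -/
structure IsWallSpace (Y : CubeComplex V) (side : Y.Hyperplane → V → Bool) : Prop where
  connected : Y.graph.Connected
  side_eq_iff : ∀ (h : Y.Hyperplane) (d : Y.graph.Dart),
    side h d.fst = side h d.snd ↔ Y.twoSkeleton.hyp d ≠ h
  corner_of_crosses : ∀ d e : Y.graph.Dart, d.fst = e.fst →
    Y.twoSkeleton.Crosses (Y.twoSkeleton.hyp d) (Y.twoSkeleton.hyp e) → Y.twoSkeleton.corner d e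
  eq_of_hyp_eq : ∀ d e : Y.graph.Dart, d.fst = e.fst →
    Y.twoSkeleton.hyp d = Y.twoSkeleton.hyp e → d = e
  not_crosses_self : ∀ h, ¬ Y.twoSkeleton.Crosses h h

section Walks

variable {Y : CubeComplex V}

@[simp] theorem crossed_nil (x : V) : Y.crossed (SimpleGraph.Walk.nil : Y.graph.Walk x x) = [] := rfl

@[simp] theorem crossed_cons {x y z : V} (h : Y.graph.Adj x y) (p : Y.graph.Walk y z) :
    Y.crossed (SimpleGraph.Walk.cons h p) = Y.twoSkeleton.hyp ⟨(x, y), h⟩ :: Y.crossed p := rfl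

@[simp] theorem crossed_append {x y z : V} (p : Y.graph.Walk x y) (q : Y.graph.Walk y z) :
    Y.crossed (p.append q) = Y.crossed p ++ Y.crossed q := by
  simp [crossed]

@[simp] theorem length_crossed {x y : V} (p : Y.graph.Walk x y) :
    (Y.crossed p).length = p.length := by
  simp [crossed]

theorem IsGeodesic.nil (x : V) : Y.IsGeodesic (SimpleGraph.Walk.nil : Y.graph.Walk x x) :=
  List.nodup_nil

/-- A path can be split at an edge dual to a hyperplane that it crosses. -/
theorem exists_split_of_mem_crossed {h : Y.Hyperplane} {x y : V} (p : Y.graph.Walk x y)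
    (hp : h ∈ Y.crossed p) : ∃ (f : Y.graph.Dart) (p₁ : Y.graph.Walk x f.fst)
      (p₂ : Y.graph.Walk f.snd y), Y.twoSkeleton.hyp f = h ∧
        p = p₁.append (SimpleGraph.Walk.cons f.adj p₂) := by
  induction p with
  | nil => simp at hp
  | @cons a b c hab p ih =>
    by_cases h1 : Y.twoSkeleton.hyp ⟨(a, b), hab⟩ = h
    · exact ⟨⟨(a, b), hab⟩, SimpleGraph.Walk.nil, p, h1, rfl⟩
    · rw [crossed_cons, List.mem_cons] at hp
      obtain ⟨f, p₁, p₂, h2, h3⟩ := ih (hp.resolve_left (fun e => h1 e.symm))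
      exact ⟨f, SimpleGraph.Walk.cons hab p₁, p₂, h2, by rw [h3]; rfl⟩

/-- The two edges that complete a corner to a square. -/
theorem exists_square_of_corner {d e : Y.graph.Dart} (h : Y.twoSkeleton.corner d e) :
    ∃ (z : V) (h₁ : Y.graph.Adj e.snd z) (h₂ : Y.graph.Adj d.snd z),
      Y.twoSkeleton.opp d ⟨(e.snd, z), h₁⟩ ∧ Y.twoSkeleton.opp e ⟨(d.snd, z), h₂⟩ := by
  obtain ⟨h1, z, h2⟩ := h
  refine ⟨z, h2.2.2.2.2.2.1, h2.2.2.2.2.2.2.symm, h2.reflect.rotate.rotate.rotate, ?_⟩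
  have := h2.rotate
  rwa [h1] at this

theorem crosses_of_corner {d e : Y.graph.Dart} (h : Y.twoSkeleton.corner d e) :
    Y.twoSkeleton.Crosses (Y.twoSkeleton.hyp d) (Y.twoSkeleton.hyp e) :=
  ⟨d, e, h, rfl, rfl⟩

end Walks

/-- The initial vertices of the edges dual to an oriented hyperplane are all on the same side of
it. -/
theorem side_fst_eq_of_ohyp_eq {Y : CubeComplex V} {side : Y.Hyperplane → V → Bool}
    (hside : ∀ (h : Y.Hyperplane) (d : Y.graph.Dart),
      side h d.fst = side h d.snd ↔ Y.twoSkeleton.hyp d ≠ h)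
    (hself : ∀ h, ¬ Y.twoSkeleton.Crosses h h) {d e : Y.graph.Dart}
    (h : Y.twoSkeleton.ohyp d = Y.twoSkeleton.ohyp e) :
    side (Y.twoSkeleton.hyp d) d.fst = side (Y.twoSkeleton.hyp e) e.fst := by
  refine congrArg (Quot.lift (fun d : Y.graph.Dart => side (Y.twoSkeleton.hyp d) d.fst) ?_) h
  intro d e h
  rw [← hyp_eq_of_opp h]
  have h' : Y.IsSquare d.fst d.snd e.snd e.fst := h
  refine (hside _ ⟨(d.fst, e.fst), h'.2.2.2.2.2.2.symm⟩).2 fun h1 => ?_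
  exact hself (Y.twoSkeleton.hyp d) ⟨⟨(d.fst, e.fst), h'.2.2.2.2.2.2.symm⟩, d,
    ⟨rfl, e.snd, h'.rotate.rotate.rotate⟩, h1, rfl⟩

namespace IsWallSpace

variable {Y : CubeComplex V} {side : Y.Hyperplane → V → Bool} (hY : Y.IsWallSpace side)

include hY

theorem side_fst_ne (d : Y.graph.Dart) :
    side (Y.twoSkeleton.hyp d) d.fst ≠ side (Y.twoSkeleton.hyp d) d.snd := by
  rw [Ne, hY.side_eq_iff]
  simp

theorem hyp_ne_of_crosses {h k : Y.Hyperplane} (H : Y.twoSkeleton.Crosses h k) : h ≠ k := by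
  rintro rfl
  exact hY.not_crosses_self h H

/-- The edges dual to a hyperplane all lie on the same side of any other hyperplane that does not
cross it. -/
theorem side_fst_eq_of_not_crosses {k : Y.Hyperplane} {e f : Y.graph.Dart}
    (hef : Y.twoSkeleton.hyp e = Y.twoSkeleton.hyp f) (hk : k ≠ Y.twoSkeleton.hyp e)
    (hc : ¬ Y.twoSkeleton.Crosses k (Y.twoSkeleton.hyp e)) :
    side k e.fst = side k f.fst := by
  let F : Y.graph.Dart → Prop := fun d => k ≠ Y.twoSkeleton.hyp d ∧
    ¬ Y.twoSkeleton.Crosses k (Y.twoSkeleton.hyp d) ∧ side k d.fst = true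
  have key : ∀ d d' : Y.graph.Dart,
      (Y.twoSkeleton.opp d d' ∨ d' = Y.twoSkeleton.rev d) → F d = F d' := by
    rintro d d' (h | rfl)
    · have h1 := hyp_eq_of_opp h
      by_cases h2 : ¬ Y.twoSkeleton.Crosses k (Y.twoSkeleton.hyp d)
      · have h3 : side k d.fst = side k d'.fst := by
          have h' : Y.IsSquare d.fst d.snd d'.snd d'.fst := h
          refine (hY.side_eq_iff k ⟨(d.fst, d'.fst), h'.2.2.2.2.2.2.symm⟩).2 ?_
          rintro rfl
          exact h2 ⟨⟨(d.fst, d'.fst), h'.2.2.2.2.2.2.symm⟩, d,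
            ⟨rfl, d'.snd, h'.rotate.rotate.rotate⟩, rfl, rfl⟩
        simp only [F, h1, h3]
      · simp only [F, ← h1, h2, false_and, and_false]
    · have h1 : Y.twoSkeleton.hyp (Y.twoSkeleton.rev d) = Y.twoSkeleton.hyp d := hyp_symm d
      simp only [F, h1]
      by_cases h2 : k ≠ Y.twoSkeleton.hyp d
      · have h3 : side k d.fst = side k d.snd := (hY.side_eq_iff k d).2 h2.symm
        have h4 : (Y.twoSkeleton.rev d).fst = d.snd := rfl
        rw [h4, h3]
      · simp only [h2, false_and]
  have h1 : F e = F f := congrArg (Quot.lift F key) hef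
  simpa [F, ← hef, hc, hk] using h1

/-- A path crosses every hyperplane that separates its endpoints. -/
theorem mem_crossed_of_side_ne {h : Y.Hyperplane} {x y : V} (p : Y.graph.Walk x y)
    (H : side h x ≠ side h y) : h ∈ Y.crossed p := by
  induction p with
  | nil => exact absurd rfl H
  | @cons a b c hab p ih =>
    rw [crossed_cons, List.mem_cons]
    by_cases h1 : Y.twoSkeleton.hyp ⟨(a, b), hab⟩ = h
    · exact Or.inl h1.symm
    · have := (hY.side_eq_iff h ⟨(a, b), hab⟩).2 h1
      exact Or.inr (ih (this ▸ H))

/-- A geodesic crosses exactly the hyperplanes that separate its endpoints. -/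
theorem mem_crossed_iff {h : Y.Hyperplane} {x y : V} {p : Y.graph.Walk x y}
    (hp : Y.IsGeodesic p) : h ∈ Y.crossed p ↔ side h x ≠ side h y := by
  refine ⟨fun H => ?_, hY.mem_crossed_of_side_ne p⟩
  induction p with
  | nil => simp at H
  | @cons a b c hab p ih =>
    unfold IsGeodesic at hp
    rw [crossed_cons, List.nodup_cons] at hp
    rw [crossed_cons, List.mem_cons] at H
    rcases H with rfl | H
    · have h1 := hY.side_fst_ne ⟨(a, b), hab⟩
      have h2 := mt (hY.mem_crossed_of_side_ne p) hp.1
      rw [not_not] at h2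
      rwa [← h2]
    · have h1 := (hY.side_eq_iff h ⟨(a, b), hab⟩).2 (fun e => hp.1 (e ▸ H))
      rw [show side h a = side h b from h1]
      exact ih hp.2 H

/-- An edge can be pushed, through squares, across a path all of whose hyperplanes cross the
hyperplane dual to the edge. -/
theorem exists_push {x y : V} (q : Y.graph.Walk x y) (e : Y.graph.Dart) (he : e.snd = x)
    (hq : ∀ k ∈ Y.crossed q, Y.twoSkeleton.Crosses (Y.twoSkeleton.hyp e) k) :
    ∃ (e' : Y.graph.Dart) (q' : Y.graph.Walk e.fst e'.fst), e'.snd = y ∧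
      Y.twoSkeleton.hyp e' = Y.twoSkeleton.hyp e ∧ Y.crossed q' = Y.crossed q := by
  induction q generalizing e with
  | nil => exact ⟨e, SimpleGraph.Walk.nil, he, rfl, rfl⟩
  | @cons a b c hab q ih =>
    have h1 : Y.twoSkeleton.corner e.symm ⟨(a, b), hab⟩ := by
      refine hY.corner_of_crosses _ _ he ?_
      rw [hyp_symm]
      exact hq _ (by simp)
    obtain ⟨z, h2, h3, h4, h5⟩ := exists_square_of_corner h1
    have h6 : Y.twoSkeleton.hyp ⟨(z, b), h2.symm⟩ = Y.twoSkeleton.hyp e := by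
      rw [← hyp_symm e, hyp_eq_of_opp h4]
      exact hyp_symm (Y := Y) ⟨(b, z), h2⟩
    obtain ⟨e', q', h7, h8, h9⟩ := ih ⟨(z, b), h2.symm⟩ rfl (by
      intro k hk
      rw [h6]
      exact hq k (by simp [hk]))
    exact ⟨e', SimpleGraph.Walk.cons h3 q', h7, h8.trans h6, by
      rw [crossed_cons, hyp_eq_of_opp h5, ← h9]
      rfl⟩

/-- If the first edge of a path is dual to a hyperplane crossed by the remainder, which is geodesic,
then the two edges dual to that hyperplane can be removed. -/
theorem exists_geodesic_of_mem_crossed {x y : V} (q : Y.graph.Walk x y) (hq : Y.IsGeodesic q)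
    (e : Y.graph.Dart) (he : e.snd = x) (hmem : Y.twoSkeleton.hyp e ∈ Y.crossed q) :
    ∃ q' : Y.graph.Walk e.fst y, Y.IsGeodesic q' := by
  obtain ⟨f, q₁, q₂, hf, rfl⟩ := exists_split_of_mem_crossed q hmem
  have hcr : Y.crossed (q₁.append (SimpleGraph.Walk.cons f.adj q₂)) =
      Y.crossed q₁ ++ Y.twoSkeleton.hyp f :: Y.crossed q₂ := by
    rw [crossed_append, crossed_cons]
  unfold IsGeodesic at hq
  rw [hcr] at hq
  have hq₁ : Y.IsGeodesic q₁ := hq.of_append_left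
  have hnot : Y.twoSkeleton.hyp f ∉ Y.crossed q₁ := fun h =>
    List.disjoint_of_nodup_append hq h (by simp)
  -- the hyperplanes crossed between the two edges separate these edges, hence cross their hyperplane
  obtain ⟨e', q', h1, h2, h3⟩ := hY.exists_push q₁ e he (by
    intro k hk
    by_contra hc
    have hne : k ≠ Y.twoSkeleton.hyp e := by
      rintro rfl
      exact hnot (hf ▸ hk)
    have h4 := hY.side_fst_eq_of_not_crosses (e := e) (f := f) hf.symm hne
      (fun h => hc (crosses_symm h))
    have h5 := (hY.side_eq_iff k e).2 hne.symm
    exact (hY.mem_crossed_iff hq₁).1 hk (by rw [← h4, h5, he]))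
  have h4 : e'.symm = f := hY.eq_of_hyp_eq _ _ h1 (by rw [hyp_symm, h2, hf])
  have h5 : e'.fst = f.snd := congrArg (fun d => d.snd) h4
  refine ⟨q'.append (q₂.copy h5.symm rfl), ?_⟩
  have h6 : Y.crossed (q₂.copy h5.symm rfl) = Y.crossed q₂ := by simp [crossed]
  unfold IsGeodesic
  rw [crossed_append, h6, h3]
  exact hq.sublist (by simp)

theorem exists_geodesic (x y : V) : ∃ p : Y.graph.Walk x y, Y.IsGeodesic p := by
  obtain ⟨p⟩ := hY.connected.preconnected x y
  induction p with
  | nil => exact ⟨_, IsGeodesic.nil _⟩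
  | @cons a b c hab p ih =>
    obtain ⟨q, hq⟩ := ih
    by_cases h : Y.twoSkeleton.hyp ⟨(a, b), hab⟩ ∈ Y.crossed q
    · exact hY.exists_geodesic_of_mem_crossed q hq ⟨(a, b), hab⟩ rfl h
    · exact ⟨SimpleGraph.Walk.cons hab q, List.nodup_cons.2 ⟨h, hq⟩⟩

theorem separates_iff {h : Y.Hyperplane} {x y : V} :
    Y.Separates h x y ↔ side h x ≠ side h y := by
  refine ⟨fun H => ?_, fun H p => hY.mem_crossed_of_side_ne p H⟩
  obtain ⟨p, hp⟩ := hY.exists_geodesic x y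
  exact (hY.mem_crossed_iff hp).1 (H p)

theorem length_eq_of_isGeodesic {x y : V} {p q : Y.graph.Walk x y} (hp : Y.IsGeodesic p)
    (hq : Y.IsGeodesic q) : p.length = q.length := by
  rw [← length_crossed, ← length_crossed]
  refine List.Perm.length_eq ((List.perm_ext_iff_of_nodup hp hq).2 fun h => ?_)
  rw [hY.mem_crossed_iff hp, hY.mem_crossed_iff hq]

/-- A step towards the endpoint of a geodesic, followed by a geodesic, is a geodesic. -/
theorem isGeodesic_cons {x y z : V} (hxy : Y.graph.Adj x y) (p : Y.graph.Walk y z)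
    (hp : Y.IsGeodesic p)
    (h : side (Y.twoSkeleton.hyp ⟨(x, y), hxy⟩) x ≠ side (Y.twoSkeleton.hyp ⟨(x, y), hxy⟩) z) :
    Y.IsGeodesic (SimpleGraph.Walk.cons hxy p) := by
  refine List.nodup_cons.2 ⟨fun h1 => ?_, hp⟩
  have h1 : _ ∈ Y.crossed p := h1
  rw [hY.mem_crossed_iff hp] at h1
  have h2 := hY.side_fst_ne ⟨(x, y), hxy⟩
  revert h h1 h2
  dsimp only
  generalize side _ x = a
  generalize side _ y = b
  generalize side _ z = c
  decide +revert

/-- Two edges issuing from `x`, both towards `o`, span a square. -/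
theorem corner_of_side_ne {d e : Y.graph.Dart} {o : V} (hde : d.fst = e.fst) (hne : d ≠ e)
    (hd : side (Y.twoSkeleton.hyp d) d.fst ≠ side (Y.twoSkeleton.hyp d) o)
    (he : side (Y.twoSkeleton.hyp e) e.fst ≠ side (Y.twoSkeleton.hyp e) o) :
    Y.twoSkeleton.corner d e := by
  have hh : Y.twoSkeleton.hyp d ≠ Y.twoSkeleton.hyp e := fun h =>
    hne (hY.eq_of_hyp_eq d e hde h)
  refine hY.corner_of_crosses d e hde ?_
  by_contra hc
  -- beyond `e`, a geodesic towards `o` still crosses the hyperplane dual to `d`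
  obtain ⟨q, hq⟩ := hY.exists_geodesic e.snd o
  have h1 := (hY.side_eq_iff (Y.twoSkeleton.hyp d) e).2 hh.symm
  have h2 : Y.twoSkeleton.hyp d ∈ Y.crossed q :=
    hY.mem_crossed_of_side_ne q (by rw [← h1, ← hde]; exact hd)
  have h3 := hY.side_fst_ne e
  obtain ⟨f, q₁, q₂, hf, rfl⟩ := exists_split_of_mem_crossed q h2
  have h4 := hY.side_fst_eq_of_not_crosses (k := Y.twoSkeleton.hyp e) (e := d) (f := f) hf.symm
    hh.symm (fun h => hc (crosses_symm h))
  have h5 : side (Y.twoSkeleton.hyp e) e.snd ≠ side (Y.twoSkeleton.hyp e) f.fst := by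
    rw [← h4, hde]
    exact h3.symm
  have h6 : Y.twoSkeleton.hyp e ∈
      Y.crossed (q₁.append (SimpleGraph.Walk.cons f.adj q₂)) := by
    rw [crossed_append, List.mem_append]
    exact Or.inl (hY.mem_crossed_of_side_ne q₁ h5)
  rw [hY.mem_crossed_iff hq] at h6
  revert h3 h6 he
  generalize side _ e.fst = a
  generalize side _ e.snd = b
  generalize side _ o = c
  decide +revert

/-- Oriented edges dual to the same hyperplane and starting on the same side of it are dual to the
same oriented hyperplane. -/
theorem ohyp_eq_of_hyp_eq {d e : Y.graph.Dart} (h : Y.twoSkeleton.hyp d = Y.twoSkeleton.hyp e)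
    (hs : side (Y.twoSkeleton.hyp d) d.fst = side (Y.twoSkeleton.hyp d) e.fst) :
    Y.twoSkeleton.ohyp d = Y.twoSkeleton.ohyp e := by
  rcases ohyp_eq_or_of_hyp_eq h with h1 | h1
  · exact h1
  · exfalso
    have h2 := side_fst_eq_of_ohyp_eq hY.side_eq_iff hY.not_crosses_self h1
    rw [hyp_symm, hs, h] at h2
    exact hY.side_fst_ne e h2

end IsWallSpace

/-! ### Cospecial actions give wall spaces -/

/-- If the action is cospecial, it suffices to find the sides of the hyperplanes. -/
theorem IsCospecial.isWallSpace {G : Type*} [Group G] [MulAction G V] {Y : CubeComplex V}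
    [Y.IsCubicalAction G] (hY : Y.IsCospecial G) {side : Y.Hyperplane → V → Bool}
    (hconn : Y.graph.Connected) (hside : ∀ (h : Y.Hyperplane) (d : Y.graph.Dart),
      side h d.fst = side h d.snd ↔ Y.twoSkeleton.hyp d ≠ h) : Y.IsWallSpace side where
  connected := hconn
  side_eq_iff := hside
  corner_of_crosses _ _ h H := hY.corner_of_crosses h H
  not_crosses_self := hY.not_crosses_self
  eq_of_hyp_eq d e h H := by
    rcases ohyp_eq_or_of_hyp_eq H with h1 | h1
    · exact hY.eq_of_label_eq h (label_eq_of_ohyp_eq h1)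
    · exfalso
      have h2 := side_fst_eq_of_ohyp_eq hside hY.not_crosses_self h1
      rw [hyp_symm, H, h] at h2
      exact (hside _ e).not.2 (by simp) h2

/-! ### Halfspaces of simply connected complexes -/

section Parity

variable {Y : CubeComplex V} (h : Y.Hyperplane)

open Classical in
/-- Whether two vertices are the endpoints of an edge dual to `h`. -/
noncomputable def edgeParity (x y : V) : Bool :=
  decide (∃ a : Y.graph.Adj x y, Y.twoSkeleton.hyp ⟨(x, y), a⟩ = h)

/-- The parity of the number of edges dual to `h` along an edge path, given by its vertices. -/
noncomputable def crossParity : List V → Bool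
  | [] => false
  | [_] => false
  | x :: y :: l => xor (Y.edgeParity h x y) (crossParity (y :: l))

theorem edgeParity_dart (d : Y.graph.Dart) :
    Y.edgeParity h d.fst d.snd = true ↔ Y.twoSkeleton.hyp d = h := by
  simp only [edgeParity, decide_eq_true_eq]
  exact ⟨fun ⟨_, H⟩ => H, fun H => ⟨d.adj, H⟩⟩

theorem edgeParity_comm (x y : V) : Y.edgeParity h x y = Y.edgeParity h y x := by
  simp only [edgeParity, decide_eq_decide]
  constructor
  · rintro ⟨a, ha⟩
    exact ⟨a.symm, (hyp_symm (Y := Y) ⟨(x, y), a⟩).trans ha⟩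
  · rintro ⟨a, ha⟩
    exact ⟨a.symm, (hyp_symm (Y := Y) ⟨(y, x), a⟩).trans ha⟩

theorem edgeParity_eq_of_isSquare {a b c d : V} (H : Y.IsSquare a b c d) :
    Y.edgeParity h a b = Y.edgeParity h d c := by
  have h1 := H.2.2.2.1
  have h2 := H.2.2.2.2.2.1.symm
  have h3 : Y.twoSkeleton.hyp ⟨(a, b), h1⟩ = Y.twoSkeleton.hyp ⟨(d, c), h2⟩ := hyp_eq_of_opp H
  rw [Bool.eq_iff_iff]
  refine (edgeParity_dart h ⟨(a, b), h1⟩).trans (Iff.trans ?_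
    (edgeParity_dart h ⟨(d, c), h2⟩).symm)
  rw [h3]

theorem crossParity_append_cons (p : List V) (a : V) (q : List V) :
    Y.crossParity h (p ++ a :: q) =
      xor (Y.crossParity h (p ++ [a])) (Y.crossParity h (a :: q)) := by
  induction p with
  | nil => simp [crossParity]
  | cons x p ih =>
    cases p with
    | nil => simp [crossParity]
    | cons y p =>
      simp only [List.cons_append, crossParity] at ih ⊢
      rw [ih, Bool.xor_assoc]

theorem crossParity_eq_of_homotopy {p q : List V} (H : Y.ElementaryHomotopy p q) :
    Y.crossParity h p = Y.crossParity h q := by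
  cases H with
  | backtrack p q x y H =>
    have h1 := crossParity_append_cons h p x (y :: x :: q)
    have h2 := crossParity_append_cons h p x q
    simp only [List.append_assoc, List.cons_append, List.nil_append] at h1 h2 ⊢
    rw [h1, h2, crossParity, crossParity, edgeParity_comm h y x,
      ← Bool.xor_assoc (Y.edgeParity h x y), Bool.xor_self, Bool.false_xor]
  | square p q a b c d H =>
    have h1 := crossParity_append_cons h p a (b :: c :: q)
    have h2 := crossParity_append_cons h p a (d :: c :: q)
    simp only [List.append_assoc, List.cons_append, List.nil_append] at h1 h2 ⊢
    rw [h1, h2, crossParity, crossParity, crossParity, crossParity,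
      edgeParity_eq_of_isSquare h H, edgeParity_eq_of_isSquare h H.rotate,
      Bool.xor_left_comm (Y.edgeParity h d c)]

theorem crossParity_cons_support {x y z : V} (p : Y.graph.Walk y z) :
    Y.crossParity h (x :: p.support) =
      xor (Y.edgeParity h x y) (Y.crossParity h p.support) := by
  cases p <;> rfl

theorem crossParity_append {x y z : V} (p : Y.graph.Walk x y) (q : Y.graph.Walk y z) :
    Y.crossParity h (p.append q).support =
      xor (Y.crossParity h p.support) (Y.crossParity h q.support) := by
  induction p with
  | nil => simp [crossParity]
  | cons a p ih =>
    rw [SimpleGraph.Walk.cons_append, SimpleGraph.Walk.support_cons, SimpleGraph.Walk.support_cons,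
      crossParity_cons_support, crossParity_cons_support, ih, Bool.xor_assoc]

theorem crossParity_reverse {x y : V} (p : Y.graph.Walk x y) :
    Y.crossParity h p.reverse.support = Y.crossParity h p.support := by
  induction p with
  | nil => rfl
  | @cons a b c hab p ih =>
    rw [SimpleGraph.Walk.reverse_cons, crossParity_append, ih, Bool.xor_comm,
      SimpleGraph.Walk.support_cons, SimpleGraph.Walk.support_cons, crossParity_cons_support,
      crossParity_cons_support, edgeParity_comm h b a]
    simp [crossParity]

/-- In a simply connected complex the parity of the number of crossings of a hyperplane depends only
on the endpoints of the path, so every hyperplane has two sides. -/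
theorem IsSimplyConnected.exists_side (hY : Y.IsSimplyConnected) :
    ∃ side : Y.Hyperplane → V → Bool, ∀ (h : Y.Hyperplane) (d : Y.graph.Dart),
      side h d.fst = side h d.snd ↔ Y.twoSkeleton.hyp d ≠ h := by
  obtain ⟨hconn, hloop⟩ := hY
  obtain ⟨o⟩ := hconn.nonempty
  have hclosed : ∀ (h : Y.Hyperplane) (x : V) (p : Y.graph.Walk x x),
      Y.crossParity h p.support = false := by
    intro h x p
    have : ∀ l l', Relation.EqvGen Y.ElementaryHomotopy l l' →
        Y.crossParity h l = Y.crossParity h l' := by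
      intro l l' H
      induction H with
      | rel _ _ H => exact crossParity_eq_of_homotopy h H
      | refl _ => rfl
      | symm _ _ _ ih => exact ih.symm
      | trans _ _ _ _ _ ih ih' => exact ih.trans ih'
    exact this _ _ (hloop x p)
  let w : ∀ x, Y.graph.Walk o x := fun x => (hconn.preconnected o x).some
  refine ⟨fun h x => Y.crossParity h (w x).support, fun h d => ?_⟩
  have h1 := hclosed h o ((w d.fst).append (SimpleGraph.Walk.cons d.adj (w d.snd).reverse))
  rw [crossParity_append, SimpleGraph.Walk.support_cons, crossParity_cons_support,
    crossParity_reverse] at h1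
  rw [← not_iff_not, not_not, ← edgeParity_dart]
  dsimp only
  revert h1
  generalize crossParity h _ = a
  generalize crossParity h _ = b
  generalize edgeParity h _ _ = c
  revert a b c
  decide

end Parity

/-! ### Restriction quotients -/

section Restriction

variable {Z : CubeComplex V} {W : Set Z.Hyperplane}

/-- The oriented edge `d` of `Z` projects to the oriented edge `d'` of the restriction quotient. -/
def IsLift (d : Z.graph.Dart) (d' : (Z.restriction W).graph.Dart) : Prop :=
  Z.proj W d.fst = d'.fst ∧ Z.proj W d.snd = d'.snd

theorem IsLift.symm {d : Z.graph.Dart} {d' : (Z.restriction W).graph.Dart} (h : IsLift d d') :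
    IsLift d.symm d'.symm :=
  ⟨h.2, h.1⟩

theorem IsLift.unique {d : Z.graph.Dart} {d₁ d₂ : (Z.restriction W).graph.Dart}
    (h₁ : IsLift d d₁) (h₂ : IsLift d d₂) : d₁ = d₂ := by
  apply SimpleGraph.Dart.ext
  exact Prod.ext (h₁.1.symm.trans h₂.1) (h₁.2.symm.trans h₂.2)

/-- An edge of the restriction quotient is by definition the image of a cube; one of the edges of
this cube is mapped onto it. -/
theorem IsCubical.exists_isLift (hZ : Z.IsCubical) (d' : (Z.restriction W).graph.Dart) :
    ∃ d : Z.graph.Dart, IsLift d d' := by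
  obtain ⟨hne, C, hC, hab⟩ := d'.adj
  obtain ⟨n, f, hf, rfl, hface⟩ := hZ.cube C hC
  set a := d'.fst
  set b := d'.snd
  have hmem : ∀ z, Z.proj W (f z) = a ∨ Z.proj W (f z) = b := by
    intro z
    have : Z.proj W (f z) ∈ ({a, b} : Set (Z.RestrictionVertex W)) := by
      rw [hab]
      exact ⟨_, ⟨z, rfl⟩, rfl⟩
    exact this
  obtain ⟨_, ⟨x, rfl⟩, hx⟩ : a ∈ Z.proj W '' Set.range f := hab ▸ Or.inl rfl
  obtain ⟨_, ⟨y, rfl⟩, hy⟩ : b ∈ Z.proj W '' Set.range f := hab ▸ Or.inr rfl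
  -- change the coordinates of `x` into those of `y` one at a time
  let pt : Finset (Fin n) → Fin n → Bool := fun S i => if i ∈ S then y i else x i
  have hstep : ∃ (S : Finset (Fin n)) (i : Fin n), Z.proj W (f (pt S)) = a ∧
      Z.proj W (f (pt (insert i S))) = b := by
    by_contra! hcon
    have hall : ∀ S : Finset (Fin n), Z.proj W (f (pt S)) = a := by
      intro S
      induction S using Finset.induction_on with
      | empty => simpa [pt] using hx
      | insert i S _ ih => exact (hmem _).resolve_right (hcon S i ih)
    have := hall Finset.univ
    simp only [pt, Finset.mem_univ, if_true] at this
    exact hne (this.symm.trans hy)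
  obtain ⟨S, i, h1, h2⟩ := hstep
  have h3 : f (pt S) ≠ f (pt (insert i S)) := by
    intro h
    rw [h] at h1
    exact hne (h1.symm.trans h2)
  have hoff : ∀ j, j ≠ i → pt (insert i S) j = pt S j := by
    intro j hj
    simp [pt, hj]
  have hi : pt (insert i S) i ≠ pt S i := by
    intro h
    refine h3 (congrArg f (funext fun j => ?_))
    by_cases hj : j = i
    · rw [hj, h]
    · exact (hoff j hj).symm
  have h4 : ({f (pt S), f (pt (insert i S))} : Set V) ∈ Z.cubes := by
    refine (hface _ ?_).2 ⟨{i}ᶜ, pt S, ?_⟩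
    · rintro _ (rfl | rfl) <;> exact ⟨_, rfl⟩
    · rw [← Set.image_pair]
      congr 1
      ext z
      simp only [Set.mem_insert_iff, Set.mem_singleton_iff, Set.mem_compl_iff, Set.mem_ofPred_eq]
      constructor
      · rintro (rfl | rfl)
        · exact fun _ _ => rfl
        · exact hoff
      · intro hz
        by_cases h5 : z i = pt S i
        · left
          funext j
          by_cases hj : j = i
          · rw [hj, h5]
          · exact hz j hj
        · right
          funext j
          by_cases hj : j = i
          · subst hj
            exact (Bool.eq_not_of_ne h5).trans (Bool.eq_not_of_ne hi).symm
          · rw [hz j hj, hoff j hj]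
  exact ⟨⟨(_, _), h3, h4⟩, h1, h2⟩

namespace IsWallSpace

variable {side : Z.Hyperplane → V → Bool} (hZ : Z.IsWallSpace side)

include hZ

theorem proj_eq_iff {x y : V} : Z.proj W x = Z.proj W y ↔ ∀ h ∈ W, side h x = side h y := by
  refine Quotient.eq.trans ?_
  refine forall₂_congr fun h _ => ?_
  rw [hZ.separates_iff, not_not]

theorem side_eq_of_proj_eq {x y : V} (h : Z.proj W x = Z.proj W y) {k : Z.Hyperplane}
    (hk : k ∈ W) : side k x = side k y :=
  hZ.proj_eq_iff.1 h k hk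

theorem hyp_mem_of_isLift {d : Z.graph.Dart} {d' : (Z.restriction W).graph.Dart}
    (h : IsLift d d') : Z.twoSkeleton.hyp d ∈ W := by
  by_contra hW
  refine d'.adj.1 ?_
  rw [← h.1, ← h.2, hZ.proj_eq_iff]
  intro k hk
  rw [hZ.side_eq_iff]
  rintro rfl
  exact hW hk

theorem proj_adj {d : Z.graph.Dart} (hW : Z.twoSkeleton.hyp d ∈ W) :
    (Z.restriction W).graph.Adj (Z.proj W d.fst) (Z.proj W d.snd) :=
  ⟨fun h => hZ.side_fst_ne d (hZ.side_eq_of_proj_eq h hW), _, d.adj.2, (Set.image_pair _ _ _).symm⟩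

theorem proj_eq_of_hyp_notMem {d : Z.graph.Dart} (hW : Z.twoSkeleton.hyp d ∉ W) :
    Z.proj W d.fst = Z.proj W d.snd := by
  rw [hZ.proj_eq_iff]
  intro k hk
  rw [hZ.side_eq_iff]
  rintro rfl
  exact hW hk

theorem exists_isLift_of_mem {d : Z.graph.Dart} (hW : Z.twoSkeleton.hyp d ∈ W) :
    ∃ d' : (Z.restriction W).graph.Dart, IsLift d d' :=
  ⟨⟨(_, _), hZ.proj_adj hW⟩, rfl, rfl⟩

theorem proj_eq_of_crossed {x y : V} (p : Z.graph.Walk x y) (hp : ∀ k ∈ Z.crossed p, k ∉ W) :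
    Z.proj W x = Z.proj W y := by
  rw [hZ.proj_eq_iff]
  intro h hW
  by_contra hne
  exact hp h (hZ.mem_crossed_of_side_ne p hne) hW

theorem restriction_connected : (Z.restriction W).graph.Connected := by
  have := hZ.connected.nonempty
  refine { preconnected := ?_, nonempty := ⟨Z.proj W this.some⟩ }
  intro x y
  induction x using Quotient.ind with | _ x => ?_
  induction y using Quotient.ind with | _ y => ?_
  change (Z.restriction W).graph.Reachable (Z.proj W x) (Z.proj W y)
  obtain ⟨p⟩ := hZ.connected.preconnected x y
  induction p with
  | nil => rfl
  | @cons a b c hab p ih =>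
    refine SimpleGraph.Reachable.trans ?_ ih
    by_cases hW : Z.twoSkeleton.hyp ⟨(a, b), hab⟩ ∈ W
    · exact (hZ.proj_adj hW).reachable
    · rw [show Z.proj W a = Z.proj W b from hZ.proj_eq_of_hyp_notMem hW]

/-- Edges of `Z` that project to opposite sides of a square, or to the same edge, are dual to the
same oriented hyperplane. -/
theorem ohyp_eq_of_isLift {d e : Z.graph.Dart} {d' e' : (Z.restriction W).graph.Dart}
    (hZc : Z.IsCubical) (hd : IsLift d d') (he : IsLift e e')
    (h : d' = e' ∨ (Z.restriction W).twoSkeleton.opp d' e') :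
    Z.twoSkeleton.ohyp d = Z.twoSkeleton.ohyp e := by
  have hW := hZ.hyp_mem_of_isLift hd
  have key : side (Z.twoSkeleton.hyp d) d.fst = side (Z.twoSkeleton.hyp d) e.fst ∧
      side (Z.twoSkeleton.hyp d) d.snd = side (Z.twoSkeleton.hyp d) e.snd := by
    rcases h with rfl | h
    · exact ⟨hZ.side_eq_of_proj_eq (hd.1.trans he.1.symm) hW,
        hZ.side_eq_of_proj_eq (hd.2.trans he.2.symm) hW⟩
    · have h' : (Z.restriction W).IsSquare d'.fst d'.snd e'.snd e'.fst := h
      obtain ⟨-, hac, hbd, -, hbc, -, hda⟩ := h'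
      obtain ⟨f, hf⟩ := hZc.exists_isLift ⟨(d'.fst, e'.fst), hda.symm⟩
      obtain ⟨k, hk⟩ := hZc.exists_isLift ⟨(d'.snd, e'.snd), hbc⟩
      have hf1 : Z.proj W f.fst = Z.proj W d.fst := hf.1.trans hd.1.symm
      have hf2 : Z.proj W f.snd = Z.proj W e.fst := hf.2.trans he.1.symm
      have hk1 : Z.proj W k.fst = Z.proj W d.snd := hk.1.trans hd.2.symm
      have hk2 : Z.proj W k.snd = Z.proj W e.snd := hk.2.trans he.2.symm
      -- two edges of a square with the same wall would identify opposite vertices of the square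
      have hne : ∀ {c : Z.graph.Dart} {x y z : V}, Z.proj W c.fst = Z.proj W y →
          Z.proj W c.snd = Z.proj W z → Z.proj W x ≠ Z.proj W z →
          (∀ m, side m x = side m y ↔ Z.twoSkeleton.hyp d ≠ m) →
          Z.twoSkeleton.hyp c ≠ Z.twoSkeleton.hyp d := by
        intro c x y z h1 h2 h3 h4 h5
        refine h3 (hZ.proj_eq_iff.2 fun m hm => ?_)
        have h6 := hZ.side_eq_iff m c
        rw [hZ.side_eq_of_proj_eq h1 hm, hZ.side_eq_of_proj_eq h2 hm, h5, ← h4 m] at h6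
        revert h6
        generalize side m x = a
        generalize side m y = b
        generalize side m z = c
        decide +revert
      have hkd := hne (x := d.fst) hk1 hk2 (by rw [hd.1, he.2]; exact hac)
        (fun m => hZ.side_eq_iff m d)
      have hfd := hne (x := d.snd) hf1 hf2 (by rw [hd.2, he.1]; exact hbd)
        (fun m => eq_comm.trans (hZ.side_eq_iff m d))
      have h1 := (hZ.side_eq_iff _ f).2 hfd
      have h2 := (hZ.side_eq_iff _ k).2 hkd
      rw [hZ.side_eq_of_proj_eq hf1 hW, hZ.side_eq_of_proj_eq hf2 hW] at h1
      rw [hZ.side_eq_of_proj_eq hk1 hW, hZ.side_eq_of_proj_eq hk2 hW] at h2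
      exact ⟨h1, h2⟩
  refine hZ.ohyp_eq_of_hyp_eq ?_ key.1
  have := hZ.side_fst_ne d
  rw [key.1, key.2, Ne, hZ.side_eq_iff, not_not] at this
  exact this.symm

/-- The opposite sides of a square whose dual hyperplane is not collapsed project to one edge or to
the opposite sides of a square. -/
theorem eq_or_opp_of_isLift {d e : Z.graph.Dart} {d' e' : (Z.restriction W).graph.Dart}
    (hd : IsLift d d') (he : IsLift e e') (h : Z.twoSkeleton.opp d e) :
    d' = e' ∨ (Z.restriction W).twoSkeleton.opp d' e' := by
  have h' : Z.IsSquare d.fst d.snd e.snd e.fst := h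
  have hW := hZ.hyp_mem_of_isLift hd
  have hda := h'.2.2.2.2.2.2.symm
  have hbc := h'.2.2.2.2.1
  have hfk : Z.twoSkeleton.hyp ⟨(d.fst, e.fst), hda⟩ = Z.twoSkeleton.hyp ⟨(d.snd, e.snd), hbc⟩ :=
    hyp_eq_of_opp (Y := Z) (d := ⟨(d.fst, e.fst), hda⟩) (e := ⟨(d.snd, e.snd), hbc⟩)
      h'.rotate.rotate.rotate.reflect.rotate.rotate.rotate
  by_cases hf : Z.twoSkeleton.hyp ⟨(d.fst, e.fst), hda⟩ ∈ W
  · right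
    have hcr : Z.twoSkeleton.hyp ⟨(d.fst, e.fst), hda⟩ ≠ Z.twoSkeleton.hyp d :=
      hZ.hyp_ne_of_crosses ⟨⟨(d.fst, e.fst), hda⟩, d, ⟨rfl, e.snd, h'.rotate.rotate.rotate⟩,
        rfl, rfl⟩
    have h1 : side (Z.twoSkeleton.hyp d) d.fst = side (Z.twoSkeleton.hyp d) e.fst :=
      (hZ.side_eq_iff _ ⟨(d.fst, e.fst), hda⟩).2 hcr
    have h2 : side (Z.twoSkeleton.hyp d) d.snd = side (Z.twoSkeleton.hyp d) e.snd :=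
      (hZ.side_eq_iff _ ⟨(d.snd, e.snd), hbc⟩).2 (hfk ▸ hcr)
    have h3 := hZ.side_fst_ne d
    have ha1 := hZ.proj_adj hf
    have ha2 := hZ.proj_adj (hfk ▸ hf)
    change (Z.restriction W).IsSquare d'.fst d'.snd e'.snd e'.fst
    rw [← hd.1, ← hd.2, ← he.1, ← he.2]
    refine ⟨⟨_, h'.1, ?_⟩, fun H => ?_, fun H => ?_, hZ.proj_adj hW, ha2, ?_, ha1.symm⟩
    · simp only [Set.image_insert_eq, Set.image_singleton]
    · have := hZ.side_eq_of_proj_eq H hW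
      exact h3 (this.trans h2.symm)
    · have := hZ.side_eq_of_proj_eq H hW
      exact h3 (h1.trans this.symm)
    · exact (hZ.proj_adj (hZ.hyp_mem_of_isLift he)).symm
  · left
    have h1 : Z.proj W d.fst = Z.proj W e.fst := hZ.proj_eq_of_hyp_notMem hf
    have h2 : Z.proj W d.snd = Z.proj W e.snd :=
      hZ.proj_eq_of_hyp_notMem (d := ⟨(d.snd, e.snd), hbc⟩) (hfk ▸ hf)
    apply SimpleGraph.Dart.ext
    exact Prod.ext (hd.1.symm.trans (h1.trans he.1)) (hd.2.symm.trans (h2.trans he.2))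

/-- A function of the oriented edges of the restriction quotient is constant along the images of a
chain of oriented edges of `Z` if it is so for every link of the chain; the chain may not leave the
set of edges dual to `W`, since the other edges have no image. -/
theorem apply_eq_of_isLift {β : Type*} {r : Z.graph.Dart → Z.graph.Dart → Prop}
    (F : (Z.restriction W).graph.Dart → β)
    (hr : ∀ d e, r d e → (Z.twoSkeleton.hyp d ∈ W ↔ Z.twoSkeleton.hyp e ∈ W))
    (hF : ∀ d e d' e', r d e → IsLift d d' → IsLift e e' → F d' = F e')
    {d e : Z.graph.Dart} {d' e' : (Z.restriction W).graph.Dart} (hde : Relation.EqvGen r d e)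
    (hd : IsLift d d') (he : IsLift e e') : F d' = F e' := by
  have key : (Z.twoSkeleton.hyp d ∈ W ↔ Z.twoSkeleton.hyp e ∈ W) ∧
      ∀ d' e', IsLift d d' → IsLift e e' → F d' = F e' := by
    clear hd he
    induction hde with
    | rel d e h => exact ⟨hr d e h, fun d' e' => hF d e d' e' h⟩
    | refl d => exact ⟨Iff.rfl, fun d' e' h1 h2 => by rw [h1.unique h2]⟩
    | symm d e _ ih => exact ⟨ih.1.symm, fun d' e' h1 h2 => (ih.2 e' d' h2 h1).symm⟩
    | trans d e f _ _ ih ih' =>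
      refine ⟨ih.1.trans ih'.1, fun d' f' h1 h2 => ?_⟩
      obtain ⟨e', he'⟩ := hZ.exists_isLift_of_mem (ih.1.1 (hZ.hyp_mem_of_isLift h1))
      exact (ih.2 d' e' h1 he').trans (ih'.2 e' f' he' h2)
  exact key.2 d' e' hd he

/-- The hyperplanes of the restriction quotient correspond to the elements of `W`. -/
theorem restriction_hyp_eq_iff (hZc : Z.IsCubical) {d e : Z.graph.Dart}
    {d' e' : (Z.restriction W).graph.Dart} (hd : IsLift d d') (he : IsLift e e') :
    (Z.restriction W).twoSkeleton.hyp d' = (Z.restriction W).twoSkeleton.hyp e' ↔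
      Z.twoSkeleton.hyp d = Z.twoSkeleton.hyp e := by
  constructor
  · intro h
    choose lift hlift using hZc.exists_isLift (W := W)
    have hyp_of_ohyp : ∀ {a b : Z.graph.Dart}, Z.twoSkeleton.ohyp a = Z.twoSkeleton.ohyp b →
        Z.twoSkeleton.hyp a = Z.twoSkeleton.hyp b := fun h =>
      congrArg (Quot.lift Z.twoSkeleton.hyp (fun _ _ h => hyp_eq_of_opp h)) h
    have key : ∀ a b : (Z.restriction W).graph.Dart,
        ((Z.restriction W).twoSkeleton.opp a b ∨ b = (Z.restriction W).twoSkeleton.rev a) →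
        Z.twoSkeleton.hyp (lift a) = Z.twoSkeleton.hyp (lift b) := by
      rintro a b (h | rfl)
      · exact hyp_of_ohyp (hZ.ohyp_eq_of_isLift hZc (hlift a) (hlift b) (Or.inr h))
      · rw [← hyp_symm (lift a)]
        exact hyp_of_ohyp (hZ.ohyp_eq_of_isLift hZc (hlift a).symm (hlift _) (Or.inl rfl))
    have h1 := congrArg (Quot.lift _ key) h
    rw [hyp_of_ohyp (hZ.ohyp_eq_of_isLift hZc hd (hlift d') (Or.inl rfl)),
      hyp_of_ohyp (hZ.ohyp_eq_of_isLift hZc he (hlift e') (Or.inl rfl))]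
    exact h1
  · intro h
    refine hZ.apply_eq_of_isLift _ ?_ ?_ (Quot.eqvGen_exact h) hd he
    · rintro d e h
      rw [show Z.twoSkeleton.hyp d = Z.twoSkeleton.hyp e from Quot.sound h]
    · rintro d e d' e' (h | rfl) hd he
      · rcases hZ.eq_or_opp_of_isLift hd he h with rfl | h
        · rfl
        · exact hyp_eq_of_opp h
      · rw [← hyp_symm d', hd.symm.unique he]

end IsWallSpace

end Restriction

/-! ### Labels of a restriction quotient -/

section RestrictionLabels

variable {Z : CubeComplex V} {W : Set Z.Hyperplane}

/-- The restriction quotient has the sides of the hyperplanes in `W`. -/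
theorem IsWallSpace.exists_restriction_side {side : Z.Hyperplane → V → Bool}
    (hZ : Z.IsWallSpace side) (hZc : Z.IsCubical) :
    ∃ side' : (Z.restriction W).Hyperplane → Z.RestrictionVertex W → Bool,
      (∀ (h : (Z.restriction W).Hyperplane) (d : (Z.restriction W).graph.Dart),
        side' h d.fst = side' h d.snd ↔ (Z.restriction W).twoSkeleton.hyp d ≠ h) ∧
      ∀ (d : Z.graph.Dart) (d' : (Z.restriction W).graph.Dart), IsLift d d' →
        ∀ x, side' ((Z.restriction W).twoSkeleton.hyp d') (Z.proj W x) =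
          side (Z.twoSkeleton.hyp d) x := by
  choose lift hlift using hZc.exists_isLift (W := W)
  have hout : ∀ h : (Z.restriction W).Hyperplane,
      (Z.restriction W).twoSkeleton.hyp (Quot.out h) = h := fun h => Quot.out_eq h
  let side' : (Z.restriction W).Hyperplane → Z.RestrictionVertex W → Bool := fun h x =>
    side (Z.twoSkeleton.hyp (lift (Quot.out h))) (Quotient.out x)
  have hside' : ∀ (d : Z.graph.Dart) (d' : (Z.restriction W).graph.Dart), IsLift d d' →
        ∀ x, side' ((Z.restriction W).twoSkeleton.hyp d') (Z.proj W x) =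
          side (Z.twoSkeleton.hyp d) x := by
    intro d d' hd x
    have h1 := (hZ.restriction_hyp_eq_iff hZc (hlift _) hd).1
      (hout ((Z.restriction W).twoSkeleton.hyp d'))
    have h2 : Z.proj W (Quotient.out (Z.proj W x)) = Z.proj W x := Quotient.out_eq _
    dsimp only [side']
    rw [h1]
    exact hZ.side_eq_of_proj_eq h2 (hZ.hyp_mem_of_isLift hd)
  refine ⟨side', fun h d' => ?_, hside'⟩
  obtain ⟨d, hd⟩ := hZc.exists_isLift d'
  rw [← hout h, ← hd.1, ← hd.2, hside' _ _ (hlift _), hside' _ _ (hlift _), hZ.side_eq_iff]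
  exact (hZ.restriction_hyp_eq_iff hZc hd (hlift _)).not.symm

variable {Γ : Type*} [Group Γ] [MulAction Γ V] [Z.IsCubicalAction Γ] [Z.IsInvariant Γ W]
  {H : Subgroup Γ}

theorem IsLift.smul (g : H) {d : Z.graph.Dart} {d' : (Z.restriction W).graph.Dart}
    (h : IsLift d d') : IsLift (g • d) (g • d') :=
  ⟨congrArg (g • ·) h.1, congrArg (g • ·) h.2⟩

theorem smul_hyp_mem_iff (g : H) {h : Z.Hyperplane} : g • h ∈ W ↔ h ∈ W := by
  refine ⟨fun h1 => ?_, fun h1 => IsInvariant.smul_mem (g : Γ) h h1⟩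
  have := IsInvariant.smul_mem (g⁻¹ : Γ) _ h1
  rwa [show (g • h : Z.Hyperplane) = (g : Γ) • h from by
    induction h using Quot.ind with | _ d => rfl, inv_smul_smul] at this

theorem hyp_mem_iff_of_label_eq {d e : Z.graph.Dart} (h : Z.label H d = Z.label H e) :
    Z.twoSkeleton.hyp d ∈ W ↔ Z.twoSkeleton.hyp e ∈ W := by
  have := apply_eq_of_label_eq (fun d => Z.twoSkeleton.hyp d ∈ W)
    (fun g d => propext (smul_hyp_mem_iff g (h := Z.twoSkeleton.hyp d))) (fun d e h => by rw [hyp_eq_of_opp h]) h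
  exact iff_of_eq this

/-- Two oriented edges dual to `W` have the same label if and only if their images in the restriction
quotient do. Injectivity of the map of alphabets is one direction, well-definedness the other. -/
theorem IsWallSpace.restriction_label_eq_iff {side : Z.Hyperplane → V → Bool}
    (hZ : Z.IsWallSpace side) (hZc : Z.IsCubical) {d e : Z.graph.Dart}
    {d' e' : (Z.restriction W).graph.Dart} (hd : IsLift d d') (he : IsLift e e') :
    (Z.restriction W).label H d' = (Z.restriction W).label H e' ↔
      Z.label H d = Z.label H e := by
  constructor
  · intro h
    choose lift hlift using hZc.exists_isLift (W := W)
    have h1 : Z.label H (lift d') = Z.label H (lift e') := by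
      refine apply_eq_of_label_eq (fun d' => Z.label H (lift d')) ?_ ?_ h
      · intro g d
        rw [← label_smul g (lift d)]
        exact label_eq_of_ohyp_eq
          (hZ.ohyp_eq_of_isLift hZc (hlift _) ((hlift d).smul g) (Or.inl rfl))
      · intro d e h
        exact label_eq_of_ohyp_eq (hZ.ohyp_eq_of_isLift hZc (hlift _) (hlift _) (Or.inr h))
    rw [label_eq_of_ohyp_eq (hZ.ohyp_eq_of_isLift hZc hd (hlift d') (Or.inl rfl)), h1,
      label_eq_of_ohyp_eq (hZ.ohyp_eq_of_isLift hZc he (hlift e') (Or.inl rfl))]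
  · intro h
    let r : Z.graph.Dart → Z.graph.Dart → Prop :=
      fun d e => Z.twoSkeleton.opp d e ∨ ∃ g : H, e = g • d
    have h1 : Quot.mk r d = Quot.mk r e :=
      apply_eq_of_label_eq (Quot.mk r) (fun g d =>
        (Quot.sound (show r d (g • d) from Or.inr ⟨g, rfl⟩)).symm)
        (fun d e h => Quot.sound (show r d e from Or.inl h)) h
    refine hZ.apply_eq_of_isLift _ ?_ ?_ (Quot.eqvGen_exact h1) hd he
    · rintro d e (h | ⟨g, rfl⟩)
      · rw [hyp_eq_of_opp h]
      · exact (smul_hyp_mem_iff g).symm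
    · rintro d e d' e' (h | ⟨g, rfl⟩) hd he
      · rcases hZ.eq_or_opp_of_isLift hd he h with rfl | h
        · rfl
        · exact label_eq_of_opp h
      · rw [(he.unique (hd.smul g)), label_smul]

/-- The inclusion of the alphabet of the restriction quotient into that of `Z`. -/
theorem IsWallSpace.exists_label_map {side : Z.Hyperplane → V → Bool}
    (hZ : Z.IsWallSpace side) (hZc : Z.IsCubical) :
    ∃ ι : (Z.restriction W).Labels H → Z.Labels H, Function.Injective ι ∧
      (∀ s t, Z.Corresponds W H s t ↔ ι s = t) ∧
      (∀ d d', IsLift d d' → ι ((Z.restriction W).label H d') = Z.label H d) ∧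
      ∀ d, Z.label H d ∈ Set.range ι ↔ Z.twoSkeleton.hyp d ∈ W := by
  have hlab : ∀ s : (Z.restriction W).Labels H, ∃ d', (Z.restriction W).label H d' = s := by
    intro s
    induction s using Quot.ind with | _ s => ?_
    induction s using Quotient.ind with | _ d => ?_
    exact ⟨d, rfl⟩
  choose rep hrep using hlab
  choose lift hlift using hZc.exists_isLift (W := W)
  let ι : (Z.restriction W).Labels H → Z.Labels H := fun s => Z.label H (lift (rep s))
  have hι : ∀ d d', IsLift d d' → ι ((Z.restriction W).label H d') = Z.label H d :=
    fun d d' hd => (hZ.restriction_label_eq_iff hZc (hlift _) hd).1 (hrep _)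
  refine ⟨ι, ?_, ?_, hι, ?_⟩
  · intro s t h
    rw [← hrep s, ← hrep t]
    exact (hZ.restriction_label_eq_iff hZc (hlift _) (hlift _)).2 h
  · intro s t
    constructor
    · rintro ⟨d, d', h1, h2, rfl, rfl⟩
      exact hι d d' ⟨h1, h2⟩
    · rintro rfl
      exact ⟨lift (rep s), rep s, (hlift _).1, (hlift _).2, hrep s, rfl⟩
  · intro d
    constructor
    · rintro ⟨s, hs⟩
      exact (hyp_mem_iff_of_label_eq hs).1 (hZ.hyp_mem_of_isLift (hlift _))
    · intro hd
      obtain ⟨d', hd'⟩ := hZ.exists_isLift_of_mem hd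
      exact ⟨_, hι d d' hd'⟩

end RestrictionLabels

/-! ### Finiteness -/

section Finiteness

variable {Z : CubeComplex V} {Γ : Type*} [Group Γ] [MulAction Γ V]

/-- A subgroup of finite index has finitely many orbits if every orbit of the group meets a given
finite set. -/
theorem finite_orbits_of_finiteIndex {α : Type*} [MulAction Γ α] (H : Subgroup Γ)
    (hH : H.FiniteIndex) (F : Set α) (hF : F.Finite) (hcov : ∀ a : α, ∃ g : Γ, ∃ b ∈ F, a = g • b) :
    Finite (MulAction.orbitRel.Quotient H α) := by
  have := hF.to_subtype
  have : Finite (Γ ⧸ H) := Subgroup.finite_quotient_of_finiteIndex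
  let f : (Γ ⧸ H) × F → MulAction.orbitRel.Quotient H α := fun p =>
    Quotient.mk _ ((Quotient.out p.1)⁻¹ • (p.2 : α))
  refine Finite.of_surjective f fun q => ?_
  induction q using Quotient.ind with | _ a => ?_
  obtain ⟨g, b, hb, rfl⟩ := hcov a
  refine ⟨(QuotientGroup.mk g⁻¹, ⟨b, hb⟩), Quotient.sound ?_⟩
  obtain ⟨h, hh⟩ := QuotientGroup.mk_out_eq_mul H g⁻¹
  refine ⟨h⁻¹, ?_⟩
  change (h⁻¹ : Γ) • g • b = (Quotient.out (QuotientGroup.mk g⁻¹ : Γ ⧸ H))⁻¹ • b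
  have h1 : (Quotient.out (QuotientGroup.mk g⁻¹ : Γ ⧸ H)) = g⁻¹ * h := hh
  rw [h1, mul_inv_rev, inv_inv, mul_smul]

theorem IsCocompact.finite_vertices (hcub : Z.IsCubical) (hZ : Z.IsCocompact Γ) (H : Subgroup Γ)
    (hH : H.FiniteIndex) : Finite (MulAction.orbitRel.Quotient H V) := by
  obtain ⟨F, hF, hcov⟩ := hZ
  refine finite_orbits_of_finiteIndex H hH {x | ({x} : Set V) ∈ F}
    (hF.preimage (f := fun x : V => ({x} : Set V)) Set.singleton_injective.injOn) fun x => ?_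
  obtain ⟨D, hD, g, hg⟩ := hcov _ (hcub.vertex x)
  obtain ⟨y, hy, hyx⟩ : x ∈ (fun x => g • x) '' D := hg ▸ rfl
  refine ⟨g, y, ?_, hyx.symm⟩
  have : D = {y} := by
    refine Set.eq_singleton_iff_unique_mem.2 ⟨hy, fun z hz => ?_⟩
    have h1 : g • z ∈ ({x} : Set V) := hg ▸ ⟨z, hz, rfl⟩
    exact MulAction.injective g (h1.trans hyx.symm)
  rw [this] at hD
  exact hD

theorem IsCocompact.finite_labels [Z.IsCubicalAction Γ] (hZ : Z.IsCocompact Γ) (H : Subgroup Γ)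
    (hH : H.FiniteIndex) : Finite (Z.Labels H) := by
  obtain ⟨F, hF, hcov⟩ := hZ
  have : Finite (MulAction.orbitRel.Quotient H Z.graph.Dart) := by
    refine finite_orbits_of_finiteIndex H hH {d | ({d.fst, d.snd} : Set V) ∈ F} ?_ fun d => ?_
    · refine (hF.biUnion (t := fun D => {d : Z.graph.Dart | ({d.fst, d.snd} : Set V) = D})
        fun D _ => ?_).subset fun d hd => Set.mem_biUnion hd rfl
      rcases Set.eq_empty_or_nonempty {d : Z.graph.Dart | ({d.fst, d.snd} : Set V) = D} with
        h | ⟨e, rfl⟩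
      · rw [h]
        exact Set.finite_empty
      · refine Set.Finite.subset (Set.toFinite {e, e.symm}) fun d hd => ?_
        have h1 : d.fst ∈ ({e.fst, e.snd} : Set V) := hd ▸ Or.inl rfl
        have h2 : d.snd ∈ ({e.fst, e.snd} : Set V) := hd ▸ Or.inr rfl
        have h3 := d.adj.1
        rcases h1 with h1 | h1 <;> rcases h2 with h2 | h2
        · exact absurd (h1.trans h2.symm) h3
        · exact Or.inl (SimpleGraph.Dart.ext _ _ (Prod.ext h1 h2))
        · exact Or.inr (SimpleGraph.Dart.ext _ _ (Prod.ext h1 h2))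
        · exact absurd (h1.trans h2.symm) h3
    · obtain ⟨D, hD, g, hg⟩ := hcov _ d.adj.2
      refine ⟨g, g⁻¹ • d, ?_, (smul_inv_smul g d).symm⟩
      have : ({(g⁻¹ • d).fst, (g⁻¹ • d).snd} : Set V) = D := by
        have h1 := congrArg (fun S => (fun x => g⁻¹ • x) '' S) hg
        simp only [Set.image_pair, Set.image_image, inv_smul_smul, Set.image_id'] at h1
        exact h1
      rw [← this] at hD
      exact hD
  exact Finite.of_surjective (Quot.mk _ : _ → Z.Labels H) Quot.mk_surjective

end Finiteness

/-! ### Normal forms of geodesics -/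

section NormalForm

variable {G : Type*} [Group G] [MulAction G V] (Y : CubeComplex V) [Y.IsCubicalAction G]

variable (G) in
/-- The labels of the oriented edges that issue from `x` towards `o`. -/
def downLabels (o x : V) : Set (Y.Labels G) :=
  {t | ∃ d : Y.graph.Dart, d.fst = x ∧ Y.label G d = t ∧
    Y.Separates (Y.twoSkeleton.hyp d) x o}

/-- `y` is the successor along an edge labeled `s` of the vertex `x` in the normal form, based at
`o`, of `y`: among the edges issuing from `y` towards `o`, the one leading to `x` has the label of
smallest rank. -/
def NormalStep (r : Y.Labels G → ℕ) (o x : V) (s : Y.Labels G) (y : V) : Prop :=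
  ∃ d : Y.graph.Dart, d.fst = x ∧ d.snd = y ∧ Y.label G d = s ∧
    ¬ Y.Separates (Y.twoSkeleton.hyp d) x o ∧
    ∀ t ∈ Y.downLabels G o y, r (Y.label G d.symm) ≤ r t

variable {Y} {side : Y.Hyperplane → V → Bool} (hY : Y.IsWallSpace side) (hG : Y.IsCospecial G)
  {o : V} {r : Y.Labels G → ℕ}

include hY

theorem IsWallSpace.separates_snd_iff (d : Y.graph.Dart) (o : V) :
    Y.Separates (Y.twoSkeleton.hyp d) d.snd o ↔ ¬ Y.Separates (Y.twoSkeleton.hyp d) d.fst o := by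
  have := hY.side_fst_ne d
  rw [hY.separates_iff, hY.separates_iff]
  revert this
  generalize side _ d.fst = a
  generalize side _ d.snd = b
  generalize side _ o = c
  decide +revert

theorem IsWallSpace.separates_fst_iff_snd {d : Y.graph.Dart} {h : Y.Hyperplane}
    (hd : Y.twoSkeleton.hyp d ≠ h) (o : V) :
    Y.Separates h d.fst o ↔ Y.Separates h d.snd o := by
  rw [hY.separates_iff, hY.separates_iff, (hY.side_eq_iff h d).2 hd]

include hG

/-- After a step away from `o` along an edge with label `s`, the edges towards `o` are that edge and
those parallel to an earlier one whose hyperplane crosses the edge. -/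
theorem IsWallSpace.downLabels_snd (d : Y.graph.Dart)
    (hd : ¬ Y.Separates (Y.twoSkeleton.hyp d) d.fst o) :
    Y.downLabels G o d.snd = {t | t = Y.label G d.symm ∨
      t ∈ Y.downLabels G o d.fst ∧ Y.LabelCrosses G (Y.label G d) t} := by
  have hdown := (hY.separates_snd_iff d o).2 hd
  ext t
  constructor
  · rintro ⟨e, he, rfl, hsep⟩
    by_cases hne : d.symm = e
    · exact Or.inl (by rw [hne])
    · right
      have hc : Y.twoSkeleton.corner d.symm e := by
        refine hY.corner_of_side_ne (o := o) he.symm hne ?_ ?_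
        · rw [← hY.separates_iff, hyp_symm]
          exact hdown
        · rw [← hY.separates_iff, he]
          exact hsep
      obtain ⟨z, -, h2, -, h4⟩ := exists_square_of_corner hc
      replace h2 : Y.graph.Adj d.fst z := h2
      replace h4 : Y.twoSkeleton.opp e ⟨(d.fst, z), h2⟩ := h4
      have h5 : Y.twoSkeleton.corner d ⟨(d.fst, z), h2⟩ := by
        refine hY.corner_of_crosses _ _ rfl ?_
        have h6 := crosses_of_corner hc
        rw [hyp_symm, hyp_eq_of_opp h4] at h6
        exact h6
      refine ⟨⟨⟨(d.fst, z), h2⟩, rfl, (label_eq_of_opp h4).symm, ?_⟩, d, ⟨(d.fst, z), h2⟩, h5, rfl,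
        (label_eq_of_opp h4).symm⟩
      rw [← hyp_eq_of_opp h4, hY.separates_fst_iff_snd]
      · exact hsep
      · have := hY.hyp_ne_of_crosses (crosses_of_corner hc)
        rwa [hyp_symm] at this
  · rintro (rfl | ⟨⟨e, he, rfl, hsep⟩, hc⟩)
    · exact ⟨d.symm, rfl, rfl, by rw [hyp_symm]; exact hdown⟩
    · have hc' := hG.corner_of_labelCrosses he.symm hc
      obtain ⟨z, -, h2, -, h4⟩ := exists_square_of_corner hc'
      refine ⟨⟨(d.snd, z), h2⟩, rfl, (label_eq_of_opp h4).symm, ?_⟩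
      rw [← hyp_eq_of_opp h4, ← hY.separates_fst_iff_snd]
      · exact hsep
      · exact hY.hyp_ne_of_crosses (crosses_of_corner hc')

/-- Whether an edge can be appended to a normal form, and the labels of the edges pointing back
afterwards, depend only on the orbit of the endpoint and on the labels of the edges pointing back
from it. -/
theorem IsWallSpace.normalStep_smul {x y x₁ : V} {s : Y.Labels G} (g : G) (hx : x₁ = g • x)
    (hdown : Y.downLabels G o x = Y.downLabels G o x₁) (h : Y.NormalStep r o x s y) :
    Y.NormalStep r o x₁ s (g • y) ∧ Y.downLabels G o (g • y) = Y.downLabels G o y := by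
  obtain ⟨d, rfl, rfl, rfl, hsep, hmin⟩ := h
  subst hx
  have hsep' : ¬ Y.Separates (Y.twoSkeleton.hyp (g • d)) (g • d).fst o := by
    intro h1
    have h2 : Y.label G d ∈ Y.downLabels G o d.fst := by
      rw [hdown]
      exact ⟨g • d, rfl, label_smul g d, h1⟩
    obtain ⟨e, he, hl, h3⟩ := h2
    rw [hG.eq_of_label_eq he hl] at h3
    exact hsep h3
  have h1 : Y.downLabels G o (g • d.snd) = Y.downLabels G o d.snd := by
    refine (hY.downLabels_snd hG (g • d) hsep').trans ?_
    rw [hY.downLabels_snd hG d hsep, hdown, smul_dart_symm, label_smul, label_smul]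
    rfl
  refine ⟨⟨g • d, rfl, rfl, label_smul g d, hsep', ?_⟩, h1⟩
  rw [h1, smul_dart_symm, label_smul]
  exact hmin

theorem IsWallSpace.normalStep_predecessor_unique (hr : Function.Injective r) {x x' y : V}
    {s s' : Y.Labels G} (h : Y.NormalStep r o x s y) (h' : Y.NormalStep r o x' s' y) :
    x = x' ∧ s = s' := by
  obtain ⟨d, rfl, rfl, rfl, hsep, hmin⟩ := h
  obtain ⟨e, rfl, he, rfl, hsep', hmin'⟩ := h'
  have h1 : Y.label G d.symm ∈ Y.downLabels G o d.snd :=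
    ⟨d.symm, rfl, rfl, by rw [hyp_symm]; exact (hY.separates_snd_iff d o).2 hsep⟩
  have h2 : Y.label G e.symm ∈ Y.downLabels G o d.snd := by
    rw [← he]
    exact ⟨e.symm, rfl, rfl, by rw [hyp_symm]; exact (hY.separates_snd_iff e o).2 hsep'⟩
  have h3 : d.symm = e.symm := hG.eq_of_label_eq he.symm
    (hr (le_antisymm (hmin _ h2) (hmin' _ (he ▸ h1))))
  have h4 : d = e := by simpa using congrArg SimpleGraph.Dart.symm h3
  rw [h4]
  exact ⟨rfl, rfl⟩

omit hG in
theorem IsWallSpace.not_normalStep_base {x : V} {s : Y.Labels G} : ¬ Y.NormalStep r o x s o := by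
  rintro ⟨d, rfl, hd, -, hsep, -⟩
  have := (hY.separates_snd_iff d o).2 hsep
  rw [hd, hY.separates_iff] at this
  exact this rfl

omit hG in
/-- Every vertex other than `o` has a predecessor, which is closer to `o`. -/
theorem IsWallSpace.exists_normalStep {y z : V} (hyz : Y.graph.Adj y z) (p : Y.graph.Walk z o)
    (hp : Y.IsGeodesic (SimpleGraph.Walk.cons hyz p)) :
    ∃ (x : V) (s : Y.Labels G) (q : Y.graph.Walk x o), Y.NormalStep r o x s y ∧
      Y.IsGeodesic q ∧ q.length = p.length := by
  have hne : (Y.downLabels G o y).Nonempty := by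
    refine ⟨_, ⟨(y, z), hyz⟩, rfl, rfl, ?_⟩
    rw [hY.separates_iff, ← hY.mem_crossed_iff hp, crossed_cons]
    exact List.mem_cons_self
  have hmin : ∀ t ∈ Y.downLabels G o y, r (Function.argminOn r _ hne) ≤ r t :=
    fun t ht => Function.argminOn_le r _ ht
  obtain ⟨d, rfl, hl, hsep⟩ := Function.argminOn_mem r _ hne
  rw [← hl] at hmin
  obtain ⟨q, hq⟩ := hY.exists_geodesic d.snd o
  refine ⟨d.snd, Y.label G d.symm, q, ⟨d.symm, rfl, rfl, rfl, ?_, ?_⟩, hq, ?_⟩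
  · rw [hyp_symm, hY.separates_snd_iff, not_not]
    exact hsep
  · simpa using hmin
  · have h1 := hY.isGeodesic_cons d.adj q hq (hY.separates_iff.1 hsep)
    have h2 := hY.length_eq_of_isGeodesic h1 hp
    simpa using h2

end NormalForm

/-! ### Lifting paths from the restriction quotient -/

section Gates

variable {Z : CubeComplex V} {W : Set Z.Hyperplane} {side : Z.Hyperplane → V → Bool}

/-- A path can be split at the last edge whose dual hyperplane has a given property. -/
theorem exists_split_last {P : Z.Hyperplane → Prop} {x y : V} (p : Z.graph.Walk x y)
    (hp : ∃ k ∈ Z.crossed p, P k) : ∃ (f : Z.graph.Dart) (p₁ : Z.graph.Walk x f.fst)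
      (p₂ : Z.graph.Walk f.snd y), P (Z.twoSkeleton.hyp f) ∧ (∀ k ∈ Z.crossed p₂, ¬ P k) ∧
        p = p₁.append (SimpleGraph.Walk.cons f.adj p₂) := by
  induction p with
  | nil => simp at hp
  | @cons a b c hab p ih =>
    by_cases h1 : ∃ k ∈ Z.crossed p, P k
    · obtain ⟨f, p₁, p₂, h2, h3, h4⟩ := ih h1
      exact ⟨f, SimpleGraph.Walk.cons hab p₁, p₂, h2, h3, by rw [h4]; rfl⟩
    · obtain ⟨k, hk, hPk⟩ := hp
      rw [crossed_cons, List.mem_cons] at hk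
      rcases hk with rfl | hk
      · exact ⟨⟨(a, b), hab⟩, SimpleGraph.Walk.nil, p, hPk, fun k hk hPk => h1 ⟨k, hk, hPk⟩, rfl⟩
      · exact absurd ⟨k, hk, hPk⟩ h1

namespace IsWallSpace

variable (hZ : Z.IsWallSpace side)

include hZ

/-- From any vertex of a fibre of the projection one can go, inside the fibre, to an edge over a
given edge of the restriction quotient, without crossing any hyperplane that crosses the one dual to
the given edge: a path of minimal length has this property, since otherwise the last edge violating
it could be pushed to the end of the path and removed. -/
theorem exists_gate {z : V} {d₀ : Z.graph.Dart} {d' : (Z.restriction W).graph.Dart}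
    (hd₀ : IsLift d₀ d') (hz : Z.proj W z = d'.fst) :
    ∃ (d : Z.graph.Dart) (p : Z.graph.Walk z d.fst), IsLift d d' ∧ Z.IsGeodesic p ∧
      ∀ k ∈ Z.crossed p, k ∉ W ∧ ¬ Z.twoSkeleton.Crosses k (Z.twoSkeleton.hyp d) := by
  classical
  have hex : ∃ n, ∃ (d : Z.graph.Dart) (p : Z.graph.Walk z d.fst), IsLift d d' ∧
      Z.IsGeodesic p ∧ p.length = n := by
    obtain ⟨p, hp⟩ := hZ.exists_geodesic z d₀.fst
    exact ⟨_, d₀, p, hd₀, hp, rfl⟩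
  obtain ⟨d, p, hd, hp, hlen⟩ := Nat.find_spec hex
  have hmin : ∀ (e : Z.graph.Dart) (q : Z.graph.Walk z e.fst), IsLift e d' → Z.IsGeodesic q →
      p.length ≤ q.length := by
    intro e q he hq
    rw [hlen]
    exact Nat.find_min' hex ⟨e, q, he, hq, rfl⟩
  have hdW := hZ.hyp_mem_of_isLift hd
  have hpW : ∀ k ∈ Z.crossed p, k ∉ W := by
    intro k hk hkW
    exact (hZ.mem_crossed_iff hp).1 hk (hZ.side_eq_of_proj_eq (hz.trans hd.1.symm) hkW)
  refine ⟨d, p, hd, hp, fun k hk => ⟨hpW k hk, fun hc => ?_⟩⟩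
  -- `f` is the last edge of the path whose hyperplane crosses the one dual to `d`
  obtain ⟨f, p₁, p₂, hf, hlast, rfl⟩ := exists_split_last p
    (P := fun k => Z.twoSkeleton.Crosses k (Z.twoSkeleton.hyp d)) ⟨k, hk, hc⟩
  clear k hk hc
  unfold IsGeodesic at hp
  rw [crossed_append, crossed_cons] at hp hpW
  have hp₂ : Z.IsGeodesic (SimpleGraph.Walk.cons f.adj p₂) := hp.of_append_right
  -- a later hyperplane `k` separates `f` from the edges dual to the hyperplane of `d`, some of which
  -- lie in squares with edges dual to the hyperplane of `f`
  have hpush : ∀ k ∈ Z.crossed p₂, Z.twoSkeleton.Crosses (Z.twoSkeleton.hyp f) k := by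
    intro k hk
    by_contra hc
    obtain ⟨a, b, hab, ha, hb⟩ := id hf
    have hkW : k ∉ W := hpW k (by simp [hk])
    have h1 := hZ.side_fst_eq_of_not_crosses (k := k) (e := b) (f := d) hb
      (by rw [hb]; rintro rfl; exact hkW hdW) (by rw [hb]; exact hlast k hk)
    have h2 := hZ.side_fst_eq_of_not_crosses (k := k) (e := f) (f := a) ha.symm
      (by rintro rfl; exact (List.nodup_cons.1 hp₂).1 hk) (fun h => hc (crosses_symm h))
    have h3 : k ∈ Z.crossed (SimpleGraph.Walk.cons f.adj p₂) := List.mem_cons_of_mem _ hk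
    rw [hZ.mem_crossed_iff hp₂] at h3
    have h4 : a.fst = b.fst := hab.1
    rw [← h4] at h1
    exact h3 (h2.trans h1)
  obtain ⟨e, q, he, hef, hq⟩ := hZ.exists_push p₂ f rfl hpush
  have heW : Z.twoSkeleton.hyp e ∉ W := hef ▸ hpW (Z.twoSkeleton.hyp f) (by simp)
  have hcor : Z.twoSkeleton.corner e.symm d :=
    hZ.corner_of_crosses _ _ he (by rw [hyp_symm, hef]; exact hf)
  obtain ⟨w, h1, h2, h3, -⟩ := exists_square_of_corner hcor
  have h5 : IsLift (W := W) ⟨(e.fst, w), h2⟩ d' := by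
    refine ⟨?_, ?_⟩
    · exact (hZ.proj_eq_of_hyp_notMem heW).trans ((congrArg (Z.proj W) he).trans hd.1)
    · refine Eq.trans ?_ hd.2
      refine (hZ.proj_eq_of_hyp_notMem (d := ⟨(d.snd, w), h1⟩) ?_).symm
      rw [← hyp_eq_of_opp h3, hyp_symm]
      exact heW
  -- pushed to the end, the edge can be dropped: its initial vertex has a lift of `d'` as well
  have h6 := hmin ⟨(e.fst, w), h2⟩ (p₁.append q) h5 (by
    unfold IsGeodesic
    rw [crossed_append, hq]
    exact hp.sublist (by simp))
  have h7 : q.length = p₂.length := by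
    rw [← length_crossed, hq, length_crossed]
  simp only [SimpleGraph.Walk.length_append, SimpleGraph.Walk.length_cons] at h6
  omega

end IsWallSpace

variable (W) in
/-- A geodesic issuing from `o` such that the halfspace, away from `o`, of every collapsed
hyperplane that it crosses contains such a halfspace of a hyperplane in `W` that it crosses.
A continuation that does not return across hyperplanes in `W` thus never returns across a
collapsed one. -/
def IsShielded {o z : V} (P : Z.graph.Walk o z) : Prop :=
  Z.IsGeodesic P ∧ ∀ k ∈ Z.crossed P, k ∉ W → ∃ h ∈ W, h ∈ Z.crossed P ∧
    ∀ v, Z.Separates h v o → Z.Separates k v o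

theorem IsShielded.nil (o : V) : Z.IsShielded W (SimpleGraph.Walk.nil : Z.graph.Walk o o) :=
  ⟨IsGeodesic.nil o, by simp⟩

theorem IsWallSpace.isShielded_append (hZ : Z.IsWallSpace side) {o z : V}
    {P : Z.graph.Walk o z} (hP : Z.IsShielded W P) (d : Z.graph.Dart)
    (p : Z.graph.Walk z d.fst) (hdW : Z.twoSkeleton.hyp d ∈ W) (hp : Z.IsGeodesic p)
    (hk : ∀ k ∈ Z.crossed p, k ∉ W ∧ ¬ Z.twoSkeleton.Crosses k (Z.twoSkeleton.hyp d))
    (hsep : ¬ Z.Separates (Z.twoSkeleton.hyp d) z o) :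
    Z.IsShielded W (P.append (p.append (SimpleGraph.Walk.cons d.adj SimpleGraph.Walk.nil))) := by
  have hproj : Z.proj W z = Z.proj W d.fst := hZ.proj_eq_of_crossed p fun k h => (hk k h).1
  rw [hZ.separates_iff, not_not] at hsep
  have hcr : Z.crossed (P.append (p.append
      (SimpleGraph.Walk.cons d.adj SimpleGraph.Walk.nil))) =
      Z.crossed P ++ (Z.crossed p ++ [Z.twoSkeleton.hyp d]) := by
    rw [crossed_append, crossed_append, crossed_cons, crossed_nil]
  have hdp : Z.twoSkeleton.hyp d ∉ Z.crossed p := fun h => (hk _ h).1 hdW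
  have hdP : Z.twoSkeleton.hyp d ∉ Z.crossed P := by
    rw [hZ.mem_crossed_iff hP.1, not_not]
    exact hsep.symm
  -- to return across `k`, one would have to return across the hyperplane in `W` that shields it
  have hdisj : ∀ k ∈ Z.crossed P, k ∉ Z.crossed p := by
    intro k hkP hkp
    obtain ⟨h, hW, hhP, hsh⟩ := hP.2 k hkP (hk k hkp).1
    have h1 := (hZ.mem_crossed_iff hP.1).1 hhP
    have h2 := (hZ.mem_crossed_iff hP.1).1 hkP
    have h3 := (hZ.mem_crossed_iff hp).1 hkp
    have h4 := hsh d.fst (hZ.separates_iff.2 (by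
      rw [← hZ.side_eq_of_proj_eq hproj hW]
      exact h1.symm))
    rw [hZ.separates_iff] at h4
    revert h2 h3 h4
    generalize side k o = a
    generalize side k z = b
    generalize side k d.fst = c
    revert a b c
    decide
  refine ⟨?_, fun k hkmem hkW => ?_⟩
  · unfold IsGeodesic
    rw [hcr, List.nodup_append, List.nodup_append]
    refine ⟨hP.1, ⟨hp, by simp, ?_⟩, ?_⟩
    · rintro a ha b hb rfl
      rw [List.mem_singleton] at hb
      exact hdp (hb ▸ ha)
    · rintro a ha b hb rfl
      rw [List.mem_append, List.mem_singleton] at hb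
      rcases hb with hb | rfl
      · exact hdisj a ha hb
      · exact hdP ha
  · rw [hcr] at hkmem ⊢
    simp only [List.mem_append, List.mem_singleton] at hkmem ⊢
    rcases hkmem with hkP | hkp | rfl
    · obtain ⟨h, hW, hhP, hsh⟩ := hP.2 k hkP hkW
      exact ⟨h, hW, Or.inl hhP, hsh⟩
    · refine ⟨_, hdW, Or.inr (Or.inr rfl), fun v hv => ?_⟩
      rw [hZ.separates_iff] at hv ⊢
      have hko : side k o = side k z := by
        by_contra h
        exact hdisj k ((hZ.mem_crossed_iff hP.1).2 h) hkp
      -- a geodesic from `v` to `z` crosses the hyperplane dual to `d`, which lies beyond `k`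
      obtain ⟨q, hq⟩ := hZ.exists_geodesic v z
      rw [hko, ← hZ.mem_crossed_iff hq]
      have h1 : Z.twoSkeleton.hyp d ∈ Z.crossed q :=
        hZ.mem_crossed_of_side_ne q (by rwa [hsep])
      obtain ⟨f, q₁, q₂, hf, rfl⟩ := exists_split_of_mem_crossed q h1
      rw [crossed_append, List.mem_append]
      right
      refine hZ.mem_crossed_of_side_ne _ ?_
      rw [← hZ.side_fst_eq_of_not_crosses hf.symm (by rintro rfl; exact hdp hkp) (hk k hkp).2]
      exact ((hZ.mem_crossed_iff hp).1 hkp).symm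
    · exact absurd hdW hkW

end Gates

/-! ### Translates of paths -/

section Translates

variable {Z : CubeComplex V} {G : Type*} [Group G] [MulAction G V] [Z.IsCubicalAction G]

variable (Z) in
/-- The action of a group element as an automorphism of the 1-skeleton. -/
def smulHom (g : G) : Z.graph →g Z.graph where
  toFun x := g • x
  map_rel' h := Z.adj_smul g h

/-- The translate of a path by a group element. -/
def smulWalk (g : G) {x y : V} (p : Z.graph.Walk x y) : Z.graph.Walk (g • x) (g • y) :=
  p.map (Z.smulHom g)

theorem crossed_smulWalk (g : G) {x y : V} (p : Z.graph.Walk x y) :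
    Z.crossed (Z.smulWalk g p) = (Z.crossed p).map (g • ·) := by
  induction p with
  | nil => rfl
  | @cons a b c h p ih =>
    change g • Z.twoSkeleton.hyp ⟨(a, b), h⟩ :: Z.crossed (Z.smulWalk g p) = _
    rw [ih]
    rfl

@[simp] theorem word_append {x y z : V} (p : Z.graph.Walk x y) (q : Z.graph.Walk y z) :
    Z.word G (p.append q) = Z.word G p ++ Z.word G q := by
  simp [word]

@[simp] theorem word_nil (x : V) :
    Z.word G (SimpleGraph.Walk.nil : Z.graph.Walk x x) = [] := rfl

@[simp] theorem word_cons {x y z : V} (h : Z.graph.Adj x y) (p : Z.graph.Walk y z) :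
    Z.word G (SimpleGraph.Walk.cons h p) = Z.label G ⟨(x, y), h⟩ :: Z.word G p := rfl

theorem word_smulWalk (g : G) {x y : V} (p : Z.graph.Walk x y) :
    Z.word G (Z.smulWalk g p) = Z.word G p := by
  induction p with
  | nil => rfl
  | @cons a b c h p ih =>
    change Z.label G (g • (⟨(a, b), h⟩ : Z.graph.Dart)) :: Z.word G (Z.smulWalk g p) = _
    rw [ih, label_smul]
    rfl

end Translates

/-! ### Words leading to the lift of an edge -/

section GateWords

variable {Z : CubeComplex V} {W : Set Z.Hyperplane} {side : Z.Hyperplane → V → Bool}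
  {Γ : Type*} [Group Γ] [MulAction Γ V] [Z.IsCubicalAction Γ] [Z.IsInvariant Γ W]
  {H : Subgroup Γ}

variable (W H) in
/-- The word `u` leads from `z`, inside its fibre and without crossing hyperplanes that cross the
one dual to the edge, to the initial vertex of a lift of the edge with label `s` at the image of `z`
in the restriction quotient. -/
def IsGateWord (z : V) (s : (Z.restriction W).Labels H) (u : List (Z.Labels H)) : Prop :=
  ∃ (d : Z.graph.Dart) (d' : (Z.restriction W).graph.Dart) (p : Z.graph.Walk z d.fst),
    IsLift d d' ∧ (Z.restriction W).label H d' = s ∧ Z.word H p = u ∧ Z.IsGeodesic p ∧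
      ∀ k ∈ Z.crossed p, k ∉ W ∧ ¬ Z.twoSkeleton.Crosses k (Z.twoSkeleton.hyp d)

theorem IsGateWord.smul {z : V} {s : (Z.restriction W).Labels H} {u : List (Z.Labels H)} (g : H)
    (h : Z.IsGateWord W H z s u) : Z.IsGateWord W H (g • z) s u := by
  obtain ⟨d, d', p, hd, rfl, rfl, hp, hk⟩ := h
  refine ⟨g • d, g • d', Z.smulWalk g p, hd.smul g, label_smul g d', word_smulWalk g p,
    ?_, ?_⟩
  · unfold IsGeodesic
    rw [show Z.crossed (x := g • z) (y := (g • d).fst) (Z.smulWalk g p) =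
      (Z.crossed p).map (g • ·) from crossed_smulWalk g p]
    exact hp.map (MulAction.injective g)
  · intro k hmem
    rw [show Z.crossed (x := g • z) (y := (g • d).fst) (Z.smulWalk g p) =
      (Z.crossed p).map (g • ·) from crossed_smulWalk g p, List.mem_map] at hmem
    obtain ⟨k, hmem, rfl⟩ := hmem
    refine ⟨fun h => (hk k hmem).1 (smul_hyp_mem_iff g |>.1 h), fun h => (hk k hmem).2 ?_⟩
    exact (congrArg₂ Z.twoSkeleton.Crosses (inv_smul_smul g k)
      (inv_smul_smul g (Z.twoSkeleton.hyp d))).mp (crosses_smul g⁻¹ h)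

theorem IsGateWord.letter_notMem {z : V} {s : (Z.restriction W).Labels H}
    {u : List (Z.Labels H)} (h : Z.IsGateWord W H z s u) {t : Z.Labels H} (ht : t ∈ u) :
    ∃ d, Z.label H d = t ∧ Z.twoSkeleton.hyp d ∉ W := by
  obtain ⟨d, d', p, -, -, rfl, -, hk⟩ := h
  obtain ⟨e, he, rfl⟩ := List.mem_map.1 ht
  exact ⟨e, rfl, (hk _ (List.mem_map_of_mem he)).1⟩

end GateWords

end CubeComplex

/-! ### Automata that read off a labeled tree with finitely many types of vertices -/

namespace FiniteAutomaton

/-- Going from `z` to `z'` along successive steps with the given labels. -/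
def Runs {N : Type*} {S : Type*} (Child : N → S → N → Prop) : N → List S → N → Prop
  | z, [], z' => z = z'
  | z, s :: w, z' => ∃ y, Child z s y ∧ Runs Child y w z'

theorem Runs.snoc {N S : Type*} {Child : N → S → N → Prop} {z y z' : N} {w : List S} {s : S}
    (h : Runs Child z w y) (h' : Child y s z') : Runs Child z (w ++ [s]) z' := by
  induction w generalizing z with
  | nil =>
    cases h
    exact ⟨z', h', rfl⟩
  | cons t w ih =>
    obtain ⟨x, hx, h⟩ := h
    exact ⟨x, hx, ih h⟩

theorem runs_snoc_iff {N S : Type*} {Child : N → S → N → Prop} {z z' : N} {w : List S} {s : S} :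
    Runs Child z (w ++ [s]) z' ↔ ∃ y, Runs Child z w y ∧ Child y s z' := by
  refine ⟨fun h => ?_, fun ⟨y, h, h'⟩ => h.snoc h'⟩
  induction w generalizing z with
  | nil =>
    obtain ⟨y, hy, rfl⟩ := h
    exact ⟨z, rfl, hy⟩
  | cons t w ih =>
    obtain ⟨x, hx, h⟩ := h
    obtain ⟨y, h1, h2⟩ := ih h
    exact ⟨y, ⟨x, hx, h1⟩, h2⟩

theorem Runs.unique {N S : Type*} {Child : N → S → N → Prop}
    (hdet : ∀ z s y y', Child z s y → Child z s y' → y = y') {z y y' : N} {w : List S}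
    (h : Runs Child z w y) (h' : Runs Child z w y') : y = y' := by
  induction w generalizing z with
  | nil => exact h.symm.trans h'
  | cons s w ih =>
    obtain ⟨x, hx, h⟩ := h
    obtain ⟨x', hx', h'⟩ := h'
    cases hdet z s x x' hx hx'
    exact ih h h'

/-- Let `Child z s y` be a deterministic transition relation on a possibly infinite set, and let
`data` be a map to a finite set whose value at `z` determines the labels of the transitions issuing
from `z` and the values of `data` at their targets. Then the words read along runs from `root` form
the language of a pruned automaton, each state of which determines the value of `data` and the next
letter (or that the word ends). The automaton guesses the next letter, so a word is represented by
at most as many paths as there are guesses in the last state. -/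
theorem exists_automaton {S : Type u} [Finite S] {N Q : Type*} [Finite Q] (root : N)
    (Child : N → S → N → Prop) (data : N → Q)
    (hdet : ∀ z s y y', Child z s y → Child z s y' → y = y')
    (hdata : ∀ z z₁ s y, data z = data z₁ → Child z s y →
      ∃ y₁, Child z₁ s y₁ ∧ data y₁ = data y) :
    ∃ A : FiniteAutomaton S, A.IsPruned ∧ A.final = Set.univ ∧
      ∃ (dat : A.State → Q) (nxt : A.State → Option S),
        (∀ q ∈ A.initial, dat q = data root) ∧
        (∀ e, nxt (A.src e) = some (A.label e)) ∧
        (∀ e z, dat (A.src e) = data z → ∃ y, Child z (A.label e) y ∧ dat (A.tgt e) = data y) ∧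
        (∀ w, w ∈ A.language ↔ ∃ z, Runs Child root w z) ∧
        ∃ C : ℕ, 1 ≤ C ∧ ∀ w, (A.pathsRepresenting w).encard ≤ C := by
  classical
  -- the states, before passing to a type in the lowest universe
  let ok : Q × Option S → Prop := fun p => ∃ z w, Runs Child root w z ∧ data z = p.1 ∧
    ∀ s ∈ p.2, ∃ y, Child z s y
  obtain ⟨n, ⟨enc⟩⟩ := Finite.exists_equiv_fin {p // ok p}
  let dat : Fin n → Q := fun q => (enc.symm q).1.1
  let nxt : Fin n → Option S := fun q => (enc.symm q).1.2
  have hext : ∀ q q', dat q = dat q' → nxt q = nxt q' → q = q' := fun q q' h h' =>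
    enc.symm.injective (Subtype.ext (Prod.ext h h'))
  have hmk : ∀ z w t, Runs Child root w z → (∀ s ∈ t, ∃ y, Child z s y) →
      ∃ q, dat q = data z ∧ nxt q = t := fun z w t h h' =>
    ⟨enc ⟨(data z, t), z, w, h, rfl, h'⟩, by simp [dat], by simp [nxt]⟩
  have hstate : ∀ q, ∃ z w, Runs Child root w z ∧ data z = dat q ∧
    ∀ s ∈ nxt q, ∃ y, Child z s y := fun q => (enc.symm q).2
  let isEdge : Fin n × Fin n → Prop := fun e =>
    ∃ z s y, dat e.1 = data z ∧ nxt e.1 = some s ∧ Child z s y ∧ dat e.2 = data y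
  have hsome : ∀ e : {e // isEdge e}, ∃ s, nxt e.1.1 = some s := fun ⟨_, _, s, _, _, h, _⟩ => ⟨s, h⟩
  choose lab hlab using hsome
  let A : FiniteAutomaton S :=
    { State := Fin n
      Edge := {e // isEdge e}
      finite_state := inferInstance
      finite_edge := inferInstance
      src := fun e => e.1.1
      tgt := fun e => e.1.2
      label := lab
      initial := {q | dat q = data root}
      final := Set.univ
      initial_nonempty := by
        obtain ⟨q, hq, -⟩ := hmk root [] none rfl (by simp)
        exact ⟨q, hq⟩
      final_nonempty := by
        obtain ⟨q, -, -⟩ := hmk root [] none rfl (by simp)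
        exact ⟨q, trivial⟩ }
  have hedge : ∀ (e : A.Edge) z, dat (A.src e) = data z →
      ∃ y, Child z (A.label e) y ∧ dat (A.tgt e) = data y := by
    rintro ⟨e, z₀, s, y₀, h1, h2, h3, h4⟩ z hz
    have hs : lab ⟨e, z₀, s, y₀, h1, h2, h3, h4⟩ = s :=
      Option.some.inj ((hlab _).symm.trans h2)
    obtain ⟨y, hy, hyd⟩ := hdata z₀ z s y₀ (h1.symm.trans hz) h3
    exact ⟨y, by rw [← hs] at hy; exact hy, h4.trans hyd.symm⟩
  -- every run is followed by a path, ending in a state with an arbitrary admissible guess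
  have hpath : ∀ (w : List S) z z' w₀ t, Runs Child root w₀ z → Runs Child z w z' →
      (∀ s ∈ t, ∃ y, Child z' s y) → ∃ (q q' : Fin n) (es : List A.Edge), dat q = data z ∧
        nxt q = (w.head?).or t ∧ A.IsPath q es ∧ A.endState q es = q' ∧ dat q' = data z' ∧
        nxt q' = t ∧ es.map A.label = w := by
    intro w
    induction w with
    | nil =>
      rintro z _ w₀ t h0 rfl ht
      obtain ⟨q, h1, h2⟩ := hmk z w₀ t h0 ht
      exact ⟨q, q, [], h1, by simpa using h2, trivial, rfl, h1, h2, rfl⟩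
    | cons s w ih =>
      rintro z z' w₀ t h0 ⟨y, hy, hrun⟩ ht
      obtain ⟨q₁, q', es, h1, h2, h3, h4, h5, h6, h7⟩ := ih y z' (w₀ ++ [s]) t (h0.snoc hy) hrun ht
      obtain ⟨q, hq, hq'⟩ := hmk z w₀ (some s) h0 (by rintro _ ⟨⟩; exact ⟨y, hy⟩)
      let e : A.Edge := ⟨(q, q₁), z, s, y, hq, hq', hy, h1⟩
      have he : A.label e = s := Option.some.inj ((hlab e).symm.trans hq')
      exact ⟨q, q', e :: es, hq, by simpa using hq', ⟨rfl, h3⟩, h4, h5, h6,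
        by rw [List.map_cons, he, h7]⟩
  -- a path follows a run
  have hrun : ∀ (es : List A.Edge) (q : Fin n) z, A.IsPath q es → dat q = data z →
      ∃ z', Runs Child z (es.map A.label) z' := by
    intro es
    induction es with
    | nil => exact fun q z _ _ => ⟨z, rfl⟩
    | cons e es ih =>
      rintro q z ⟨rfl, hes⟩ hq
      obtain ⟨y, hy, hyd⟩ := hedge e z hq
      obtain ⟨z', hz'⟩ := ih _ y hes hyd
      exact ⟨z', y, hy, hz'⟩
  -- a path is determined by its word and by the guess in its last state
  have hinj : ∀ (es es' : List A.Edge) (q q' : Fin n) z, A.IsPath q es → A.IsPath q' es' →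
      dat q = data z → dat q' = data z → es.map A.label = es'.map A.label →
      nxt (A.endState q es) = nxt (A.endState q' es') → q = q' ∧ es = es' := by
    intro es
    induction es with
    | nil =>
      intro es' q q' z _ _ hq hq' hw hend
      obtain rfl : es' = [] := by simpa using hw.symm
      exact ⟨hext q q' (hq.trans hq'.symm) hend, rfl⟩
    | cons e es ih =>
      rintro (_ | ⟨e', es'⟩) q q' z hes hes' hq hq' hw hend
      · simp at hw
      obtain ⟨rfl, hes⟩ := hes
      obtain ⟨rfl, hes'⟩ := hes'
      rw [List.map_cons, List.map_cons, List.cons.injEq] at hw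
      obtain ⟨hl, hw⟩ := hw
      have hsrc : A.src e = A.src e' := hext _ _ (hq.trans hq'.symm) (by
        rw [show nxt (A.src e) = some (A.label e) from hlab e,
          show nxt (A.src e') = some (A.label e') from hlab e', hl])
      obtain ⟨y, hy, hyd⟩ := hedge e z hq
      have hyd' : dat (A.tgt e') = data y := by
        obtain ⟨y', hy', hyd'⟩ := hedge e' z hq'
        rw [← hl] at hy'
        rw [hyd', hdet _ _ _ _ hy' hy]
      obtain ⟨htgt, rfl⟩ := ih es' _ _ y hes hes' hyd hyd' hw hend
      refine ⟨hsrc, ?_⟩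
      rw [show e = e' from Subtype.ext (Prod.ext hsrc htgt)]
  refine ⟨A, fun q => ?_, rfl, dat, nxt, fun q hq => hq, hlab, hedge, fun w => ⟨?_, ?_⟩,
    Nat.card (Option S), Finite.card_pos, fun w => ?_⟩
  · obtain ⟨z, w, h0, h1, h2⟩ := hstate q
    obtain ⟨q₀, q', es, h3, -, h4, h5, h6, h7, -⟩ := hpath w root z [] (nxt q) rfl h0 h2
    exact ⟨q₀, h3, es, h4, h5.trans (hext q' q (h6.trans h1) h7)⟩
  · rintro ⟨q, hq, es, hes, -, rfl⟩
    exact hrun es q root hes hq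
  · rintro ⟨z, hz⟩
    obtain ⟨q, q', es, h1, -, h2, -, -, -, h3⟩ := hpath w root z [] none rfl hz (by simp)
    exact ⟨q, h1, es, h2, trivial, h3⟩
  · have hin : Set.InjOn (fun p : A.State × List A.Edge => nxt (A.endState p.1 p.2))
        (A.pathsRepresenting w) := by
      rintro ⟨q, es⟩ ⟨hq, hes, hw⟩ ⟨q', es'⟩ ⟨hq', hes', hw'⟩ hend
      obtain ⟨h1, h2⟩ := hinj es es' q q' root hes hes' hq hq' (hw.trans hw'.symm) hend
      exact Prod.ext h1 h2
    rw [← hin.encard_image, ← ENat.card_eq_coe_natCard, ← Set.encard_univ]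
    exact Set.encard_le_encard (Set.subset_univ _)

end FiniteAutomaton

namespace CubeComplex

/-! ### The normal form automaton of a restriction quotient -/

section

variable {V : Type u} {G : Type*} [Group G] [MulAction G V] {Y : CubeComplex V}
  [Y.IsCubicalAction G] {o : V} {r : Y.Labels G → ℕ}

theorem NormalStep.exists_adj {x y : V} {s : Y.Labels G} (h : Y.NormalStep r o x s y) :
    ∃ hxy : Y.graph.Adj x y, Y.label G ⟨(x, y), hxy⟩ = s ∧
      ¬ Y.Separates (Y.twoSkeleton.hyp ⟨(x, y), hxy⟩) x o := by
  obtain ⟨d, rfl, rfl, h1, h2, -⟩ := h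
  exact ⟨d.adj, h1, h2⟩

/-- Appending a step of the normal form to a geodesic issuing from `o` yields a geodesic. -/
theorem IsWallSpace.isGeodesic_append_normalStep {side : Y.Hyperplane → V → Bool}
    (hY : Y.IsWallSpace side) {x y : V} {P : Y.graph.Walk o x} (hP : Y.IsGeodesic P)
    (hxy : Y.graph.Adj x y) (h : ¬ Y.Separates (Y.twoSkeleton.hyp ⟨(x, y), hxy⟩) x o) :
    Y.IsGeodesic (P.append (SimpleGraph.Walk.cons hxy SimpleGraph.Walk.nil)) := by
  unfold IsGeodesic
  rw [crossed_append, crossed_cons, crossed_nil, List.nodup_append]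
  refine ⟨hP, by simp, ?_⟩
  rintro a ha b hb rfl
  rw [List.mem_singleton] at hb
  subst hb
  rw [hY.mem_crossed_iff hP] at ha
  exact h (hY.separates_iff.2 ha.symm)

/-- The word read along a normal form is determined by its endpoint. -/
theorem IsWallSpace.word_unique {side : Y.Hyperplane → V → Bool} (hY : Y.IsWallSpace side)
    (hG : Y.IsCospecial G) (hr : Function.Injective r) {x : V} {w w' : List (Y.Labels G)}
    (h : FiniteAutomaton.Runs (Y.NormalStep r o) o w x)
    (h' : FiniteAutomaton.Runs (Y.NormalStep r o) o w' x) : w = w' := by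
  induction w using List.reverseRecOn generalizing w' x with
  | nil =>
    cases h
    induction w' using List.reverseRecOn with
    | nil => rfl
    | append_singleton w' s' _ =>
      obtain ⟨y, -, hy⟩ := FiniteAutomaton.runs_snoc_iff.1 h'
      exact absurd hy hY.not_normalStep_base
  | append_singleton w s ih =>
    obtain ⟨y, hwy, hy⟩ := FiniteAutomaton.runs_snoc_iff.1 h
    induction w' using List.reverseRecOn with
    | nil =>
      cases h'
      exact absurd hy hY.not_normalStep_base
    | append_singleton w' s' _ =>
      obtain ⟨y', hwy', hy'⟩ := FiniteAutomaton.runs_snoc_iff.1 h'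
      obtain ⟨rfl, rfl⟩ := hY.normalStep_predecessor_unique hG hr hy hy'
      rw [ih hwy hwy']

end

section LiftedSteps

variable {V : Type u} {Z : CubeComplex V} {W : Set Z.Hyperplane}
  {Γ : Type*} [Group Γ] [MulAction Γ V] [Z.IsCubicalAction Γ] [Z.IsInvariant Γ W]
  {H : Subgroup Γ}

open Classical in
variable (W H) in
/-- A word leading from the vertices of an orbit to the lifts of the edges labeled `s`. -/
noncomputable def gateWord (ζ : MulAction.orbitRel.Quotient H V)
    (s : (Z.restriction W).Labels H) : List (Z.Labels H) :=
  if h : ∃ u, ∃ z, Quotient.mk _ z = ζ ∧ Z.IsGateWord W H z s u then h.choose else []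

/-- The word chosen for an orbit serves all the vertices of the orbit for which there is such a word,
because gate words are invariant under the group. -/
theorem IsGateWord.gateWord {z : V} {s : (Z.restriction W).Labels H} {u : List (Z.Labels H)}
    (h : Z.IsGateWord W H z s u) :
    Z.IsGateWord W H z s (Z.gateWord W H (Quotient.mk _ z) s) := by
  have hex : ∃ u, ∃ z', (Quotient.mk _ z' : MulAction.orbitRel.Quotient H V) = Quotient.mk _ z ∧
      Z.IsGateWord W H z' s u := ⟨u, z, rfl, h⟩
  rw [CubeComplex.gateWord, dif_pos hex]
  obtain ⟨z', hz', hw⟩ := hex.choose_spec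
  obtain ⟨g, rfl⟩ := Quotient.exact hz'
  have := hw.smul g⁻¹
  rwa [show g⁻¹ • (fun m : H => m • z) g = z from inv_smul_smul g z] at this

theorem notMem_of_mem_gateWord {ζ : MulAction.orbitRel.Quotient H V}
    {s : (Z.restriction W).Labels H} {t : Z.Labels H} (ht : t ∈ Z.gateWord W H ζ s) :
    ∃ d, Z.label H d = t ∧ Z.twoSkeleton.hyp d ∉ W := by
  by_cases h : ∃ u, ∃ z, Quotient.mk _ z = ζ ∧ Z.IsGateWord W H z s u
  · rw [gateWord, dif_pos h] at ht
    obtain ⟨z, -, hw⟩ := h.choose_spec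
    exact hw.letter_notMem ht
  · rw [gateWord, dif_neg h] at ht
    simp at ht

variable (Z W) in
/-- The lift to `Z` of the steps of the normal form in the restriction quotient: an edge is preceded
by a path inside the fibre that leads to a lift of the edge. -/
def LiftedStep (ι : (Z.restriction W).Labels H → Z.Labels H)
    (r : (Z.restriction W).Labels H → ℕ) (o z : V) (s : (Z.restriction W).Labels H) (z' : V) :
    Prop :=
  (Z.restriction W).NormalStep r (Z.proj W o) (Z.proj W z) s (Z.proj W z') ∧
    ∃ R : Z.graph.Walk z z', Z.word H R = Z.gateWord W H (Quotient.mk _ z) s ++ [ι s]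

variable {ι : (Z.restriction W).Labels H → Z.Labels H}
  {r : (Z.restriction W).Labels H → ℕ} {o : V} {side : Z.Hyperplane → V → Bool}

theorem runs_normalStep_of_runs_liftedStep {z z' : V} {w : List ((Z.restriction W).Labels H)}
    (h : FiniteAutomaton.Runs (Z.LiftedStep W ι r o) z w z') :
    FiniteAutomaton.Runs ((Z.restriction W).NormalStep r (Z.proj W o)) (Z.proj W z) w
      (Z.proj W z') := by
  induction w generalizing z with
  | nil => exact congrArg _ h
  | cons s w ih =>
    obtain ⟨y, hy, h⟩ := h
    exact ⟨_, hy.1, ih h⟩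

/-- Steps of the normal form lift, and the lifts continue shielded paths to shielded paths. -/
theorem IsWallSpace.exists_liftedStep (hZ : Z.IsWallSpace side) (hZc : Z.IsCubical)
    {side' : (Z.restriction W).Hyperplane → Z.RestrictionVertex W → Bool}
    (hX : (Z.restriction W).IsWallSpace side') (hXs : (Z.restriction W).IsCospecial H)
    (hlink : ∀ (d : Z.graph.Dart) (d' : (Z.restriction W).graph.Dart), IsLift d d' →
        ∀ x, side' ((Z.restriction W).twoSkeleton.hyp d') (Z.proj W x) =
          side (Z.twoSkeleton.hyp d) x)
    (hι : ∀ d d', IsLift d d' → ι ((Z.restriction W).label H d') = Z.label H d)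
    {z : V} {s : (Z.restriction W).Labels H} {y : Z.RestrictionVertex W}
    (h : (Z.restriction W).NormalStep r (Z.proj W o) (Z.proj W z) s y) :
    ∃ (z' : V) (R : Z.graph.Walk z z'), Z.proj W z' = y ∧
      Z.word H R = Z.gateWord W H (Quotient.mk _ z) s ++ [ι s] ∧
      ∀ P : Z.graph.Walk o z, Z.IsShielded W P → Z.IsShielded W (P.append R) := by
  obtain ⟨hadj, hl, hsep⟩ := h.exists_adj
  obtain ⟨d₀, hd₀⟩ := hZc.exists_isLift ⟨(Z.proj W z, y), hadj⟩
  obtain ⟨d₁, p₁, h1, h2, h3⟩ := hZ.exists_gate hd₀ rfl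
  have hgate : Z.IsGateWord W H z s (Z.word H p₁) := ⟨d₁, _, p₁, h1, hl, rfl, h2, h3⟩
  obtain ⟨d, d', p, hd, hd', hw, hp, hk⟩ := hgate.gateWord
  have hfst : Z.proj W z = d'.fst :=
    (hZ.proj_eq_of_crossed p fun k hk' => (hk k hk').1).trans hd.1
  have heq : (⟨(Z.proj W z, y), hadj⟩ : (Z.restriction W).graph.Dart) = d' :=
    hXs.eq_of_label_eq hfst (hl.trans hd'.symm)
  subst heq
  refine ⟨d.snd, p.append (SimpleGraph.Walk.cons d.adj SimpleGraph.Walk.nil), hd.2, ?_,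
    fun P hP => ?_⟩
  · rw [word_append, word_cons, word_nil, hw, ← hd', hι _ _ hd]
  · refine hZ.isShielded_append hP d p (hZ.hyp_mem_of_isLift hd) hp hk ?_
    rwa [hX.separates_iff, hlink _ _ hd, hlink _ _ hd, ← hZ.separates_iff] at hsep

theorem IsCospecial.liftedStep_unique (hZs : Z.IsCospecial H) {z y y' : V}
    {s : (Z.restriction W).Labels H} (h : Z.LiftedStep W ι r o z s y)
    (h' : Z.LiftedStep W ι r o z s y') : y = y' := by
  obtain ⟨-, R, hR⟩ := h
  obtain ⟨-, R', hR'⟩ := h'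
  exact congrArg Sigma.fst (hZs.eq_of_word_eq R R' (hR.trans hR'.symm))

variable (Z W H) in
/-- The information about a vertex of `Z` that is recorded by a state of the automaton. -/
def stateData (o z : V) :
    MulAction.orbitRel.Quotient H V × Set ((Z.restriction W).Labels H) :=
  (Quotient.mk _ z, (Z.restriction W).downLabels H (Z.proj W o) (Z.proj W z))

/-- The recorded information determines the possible steps and the information recorded after
them. -/
theorem IsWallSpace.exists_liftedStep_of_stateData_eq
    {side' : (Z.restriction W).Hyperplane → Z.RestrictionVertex W → Bool}
    (hX : (Z.restriction W).IsWallSpace side') (hXs : (Z.restriction W).IsCospecial H)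
    {z z₁ y : V} {s : (Z.restriction W).Labels H}
    (hz : Z.stateData W H o z = Z.stateData W H o z₁) (h : Z.LiftedStep W ι r o z s y) :
    ∃ y₁, Z.LiftedStep W ι r o z₁ s y₁ ∧ Z.stateData W H o y₁ = Z.stateData W H o y := by
  obtain ⟨h1, h2⟩ := Prod.ext_iff.1 hz
  obtain ⟨g, hg⟩ := Quotient.exact h1.symm
  replace hg : g • z = z₁ := hg
  subst hg
  obtain ⟨h3, R, hR⟩ := h
  obtain ⟨h4, h5⟩ := hX.normalStep_smul hXs g (x₁ := Z.proj W (g • z)) rfl h2 h3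
  refine ⟨g • y, ⟨h4, Z.smulWalk g R, ?_⟩, Prod.ext (Quotient.sound ⟨g, rfl⟩) h5⟩
  rw [word_smulWalk, hR]
  exact congrArg (fun ζ => Z.gateWord W H ζ s ++ [ι s]) h1

/-- Every vertex of the restriction quotient is the projection of the end of a lifted run. -/
theorem IsWallSpace.exists_runs_liftedStep
    {side' : (Z.restriction W).Hyperplane → Z.RestrictionVertex W → Bool}
    (hX : (Z.restriction W).IsWallSpace side')
    (hstep : ∀ z s y, (Z.restriction W).NormalStep r (Z.proj W o) (Z.proj W z) s y →
      ∃ z', Z.proj W z' = y ∧ Z.LiftedStep W ι r o z s z') (x : Z.RestrictionVertex W) :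
    ∃ w z, FiniteAutomaton.Runs (Z.LiftedStep W ι r o) o w z ∧ Z.proj W z = x := by
  obtain ⟨q, hq⟩ := hX.exists_geodesic x (Z.proj W o)
  induction hn : q.length generalizing x with
  | zero => exact ⟨[], o, rfl, (SimpleGraph.Walk.eq_of_length_eq_zero hn).symm⟩
  | succ n ih =>
    cases q with
    | nil => simp at hn
    | cons hxy p =>
      obtain ⟨x₀, s, q₀, h1, h2, h3⟩ := hX.exists_normalStep (G := H) (r := r) hxy p hq
      obtain ⟨w, z, h4, rfl⟩ := ih x₀ q₀ h2 (by simpa [h3] using hn)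
      obtain ⟨z', h5, h6⟩ := hstep z s x h1
      exact ⟨w ++ [s], z', h4.snoc h6, h5⟩

end LiftedSteps

section PathsInQuotient

variable {V : Type u} {Z : CubeComplex V} {W : Set Z.Hyperplane}
  {Γ : Type*} [Group Γ] [MulAction Γ V] [Z.IsCubicalAction Γ] [Z.IsInvariant Γ W]
  {H : Subgroup Γ} {ι : (Z.restriction W).Labels H → Z.Labels H}
  {r : (Z.restriction W).Labels H → ℕ} {o : V}

/-- A lifted run projects to a path that continues geodesics issuing from the base vertex. -/
theorem IsWallSpace.exists_walk_of_runs
    {side' : (Z.restriction W).Hyperplane → Z.RestrictionVertex W → Bool}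
    (hX : (Z.restriction W).IsWallSpace side') {w : List ((Z.restriction W).Labels H)} {z z' : V}
    (h : FiniteAutomaton.Runs (Z.LiftedStep W ι r o) z w z')
    (P : (Z.restriction W).graph.Walk (Z.proj W o) (Z.proj W z))
    (hP : (Z.restriction W).IsGeodesic P) :
    ∃ R : (Z.restriction W).graph.Walk (Z.proj W z) (Z.proj W z'),
      (Z.restriction W).word H R = w ∧ (Z.restriction W).IsGeodesic (P.append R) := by
  induction w generalizing z with
  | nil =>
    cases h
    exact ⟨SimpleGraph.Walk.nil, rfl, by simpa using hP⟩
  | cons s w ih =>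
    obtain ⟨y, hy, h⟩ := h
    obtain ⟨hadj, hl, hsep⟩ := hy.1.exists_adj
    obtain ⟨R, hR, hg⟩ := ih h _ (hX.isGeodesic_append_normalStep hP hadj hsep)
    refine ⟨SimpleGraph.Walk.cons hadj R, by rw [word_cons, hl, hR], ?_⟩
    rwa [← SimpleGraph.Walk.append_assoc] at hg

end PathsInQuotient

end CubeComplex

theorem mainTheorem10
    {Γ : Type*} [Group Γ] (hΓ : ¬ IsVirtuallyCyclic Γ)
    {V : Type*} [MulAction Γ V] (Z : CubeComplex V) [Z.IsCubicalAction Γ] (hZ : Z.IsCAT0)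
    (hZ_proper : Z.IsProper Γ) (hZ_cocompact : Z.IsCocompact Γ) (hZ_essential : Z.IsEssential Γ)
    -- the restriction quotient `X = Z(W)`
    (W : Set Z.Hyperplane) [Z.IsInvariant Γ W]
    (hX_proper : (Z.restriction W).IsProper Γ) (hX_cocompact : (Z.restriction W).IsCocompact Γ)
    (hX_essential : (Z.restriction W).IsEssential Γ)
    -- the finite index subgroup, and the base vertex of `Z`
    (H : Subgroup Γ) (hH : H.FiniteIndex)
    (hZ_special : Z.IsCospecial H) (hX_special : (Z.restriction W).IsCospecial H)
    (o : V) :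
    -- the natural injection of the alphabet of `X` into the alphabet of `Z`
    ∃ ι : (Z.restriction W).Labels H → Z.Labels H,
      Function.Injective ι ∧ (∀ s t, Z.Corresponds W H s t ↔ ι s = t) ∧
    Finite ((Z.restriction W).Labels H) ∧
    ∃ A : FiniteAutomaton ((Z.restriction W).Labels H),
      A.IsPruned ∧ A.final = Set.univ ∧
      -- (1)
      (∃ C : ℕ, 1 ≤ C ∧ ∀ w ∈ A.language, (A.pathsRepresenting w).encard ≤ C) ∧
      -- (2): `γ w` is the unique geodesic from the base vertex of `X` representing `w`
      ∃ γ : {w // w ∈ A.language} → (Z.restriction W).PathsFrom (Z.proj W o),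
        (∀ w δ, ((Z.restriction W).IsGeodesic δ.2 ∧ (Z.restriction W).word H δ.2 = w.1) ↔
          δ = γ w) ∧
        -- (3): the final vertex of `γ w` is `(γ w).1`
        Function.Bijective (fun w => (γ w).1) ∧
        ∃ (Ψ : A.State → List (Z.Labels H))
          (Ξ : A.State → MulAction.orbitRel.Quotient H (Z.RestrictionVertex W)),
          (∀ q, ∀ t ∈ Ψ q, t ∉ Set.range ι) ∧
          -- (4)
          (∀ w : {w // w ∈ A.language}, ∀ ω ∈ A.pathsRepresenting w.1,
            ∃ γ' : Z.PathsFrom o,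
              (∀ δ, (Z.IsGeodesic δ.2 ∧ Z.word H δ.2 = A.interleave ι Ψ ω.1 ω.2) ↔ δ = γ') ∧
              Z.proj W γ'.1 = (γ w).1) ∧
          -- (5)
          (∀ w : {w // w ∈ A.language}, ∀ ω ∈ A.pathsRepresenting w.1,
            (γ w).2.support.map ((Z.restriction W).vertexOrbit H) =
              (A.states ω.1 ω.2).map Ξ) := by

  obtain ⟨side, hside⟩ := hZ.isSimplyConnected.exists_side
  have hW : Z.IsWallSpace side := hZ_special.isWallSpace hZ.isSimplyConnected.1 hside
  obtain ⟨side', hside', hlink⟩ := hW.exists_restriction_side (W := W) hZ.isCubical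
  have hX : (Z.restriction W).IsWallSpace side' :=
    hX_special.isWallSpace hW.restriction_connected hside'
  obtain ⟨ι, hinj, hcorr, hι, hrange⟩ := hW.exists_label_map (W := W) (H := H) hZ.isCubical
  have hfin : Finite (Z.Labels H) := hZ_cocompact.finite_labels H hH
  have hfinX : Finite ((Z.restriction W).Labels H) := Finite.of_injective ι hinj
  have hfinV : Finite (MulAction.orbitRel.Quotient H V) :=
    hZ_cocompact.finite_vertices hZ.isCubical H hH
  -- an arbitrary linear order on the alphabet
  obtain ⟨n, ⟨e⟩⟩ := Finite.exists_equiv_fin ((Z.restriction W).Labels H)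
  let r : (Z.restriction W).Labels H → ℕ := fun s => e s
  have hr : Function.Injective r := fun s t h => e.injective (Fin.ext h)
  have hstep : ∀ z s y,
      (Z.restriction W).NormalStep r (Z.proj W o) (Z.proj W z) s y →
      ∃ (z' : V) (R : Z.graph.Walk z z'), Z.proj W z' = y ∧
        Z.word H R = Z.gateWord W H (Quotient.mk _ z) s ++ [ι s] ∧
        ∀ P : Z.graph.Walk o z, Z.IsShielded W P → Z.IsShielded W (P.append R) :=
    fun z s y => hW.exists_liftedStep hZ.isCubical hX hX_special hlink hι
  have hdet : ∀ z s y y', Z.LiftedStep W ι r o z s y → Z.LiftedStep W ι r o z s y' → y = y' :=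
    fun z s y y' => hZ_special.liftedStep_unique
  have hsurj := hX.exists_runs_liftedStep (ι := ι) (r := r) (o := o) fun z s y h => by
    obtain ⟨z', R, h1, h2, -⟩ := hstep z s y h
    exact ⟨z', h1, by rwa [← h1] at h, R, h2⟩
  obtain ⟨A, hpruned, hfinal, dat, nxt, hinit, hnxt, hedge, hlang, C, hC, hcard⟩ :=
    FiniteAutomaton.exists_automaton o (Z.LiftedStep W ι r o) (Z.stateData W H o) hdet
      fun z z₁ s y => hX.exists_liftedStep_of_stateData_eq hX_special
  -- the geodesics of the restriction quotient represented by the words of the language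
  have hgeo : ∀ w : {w // w ∈ A.language}, ∃ δ : (Z.restriction W).PathsFrom (Z.proj W o),
      (∃ z, FiniteAutomaton.Runs (Z.LiftedStep W ι r o) o w.1 z ∧ Z.proj W z = δ.1) ∧
        (Z.restriction W).IsGeodesic δ.2 ∧ (Z.restriction W).word H δ.2 = w.1 := by
    rintro ⟨w, hw⟩
    obtain ⟨z, hz⟩ := (hlang w).1 hw
    obtain ⟨R, h1, h2⟩ := hX.exists_walk_of_runs hz SimpleGraph.Walk.nil (CubeComplex.IsGeodesic.nil _)
    exact ⟨⟨_, R⟩, ⟨z, hz, rfl⟩, h2, h1⟩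
  choose γ hγend hγgeo hγword using hgeo
  let Ψ : A.State → List (Z.Labels H) := fun q =>
    (nxt q).elim [] (Z.gateWord W H (dat q).1)
  let Ξ : A.State → MulAction.orbitRel.Quotient H (Z.RestrictionVertex W) := fun q =>
    Quotient.map (Z.proj W) (by rintro _ y ⟨g, rfl⟩; exact ⟨g, rfl⟩) (dat q).1
  have hΞ : ∀ q z, dat q = Z.stateData W H o z →
      Ξ q = (Z.restriction W).vertexOrbit H (Z.proj W z) := by
    intro q z hq
    simp only [Ξ, hq]
    rfl
  -- the lifts to `Z` of the paths of the automaton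
  have hlift : ∀ (es : List A.Edge) (q : A.State) (z : V), A.IsPath q es →
      dat q = Z.stateData W H o z → ∀ P : Z.graph.Walk o z, Z.IsShielded W P →
      ∃ (z' : V) (R : Z.graph.Walk z z'), FiniteAutomaton.Runs (Z.LiftedStep W ι r o) z (es.map A.label) z' ∧
        Z.word H R = A.interleave ι Ψ q es ∧ Z.IsShielded W (P.append R) := by
    intro es
    induction es with
    | nil => exact fun q z _ _ P hP => ⟨z, SimpleGraph.Walk.nil, rfl, rfl, by simpa using hP⟩
    | cons e es ih =>
      rintro q z ⟨rfl, hes⟩ hq P hP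
      obtain ⟨y, hy, hyd⟩ := hedge e z hq
      obtain ⟨y', R, h1, h2, h3⟩ := hstep z _ _ hy.1
      obtain rfl : y' = y := hdet z _ _ _ ⟨by rw [h1]; exact hy.1, R, h2⟩ hy
      obtain ⟨z', R', h4, h5, h6⟩ := ih _ y' hes hyd (P.append R) (h3 P hP)
      refine ⟨z', R.append R', ⟨y', hy, h4⟩, ?_, by rwa [← SimpleGraph.Walk.append_assoc] at h6⟩
      rw [CubeComplex.word_append, h2, h5, FiniteAutomaton.interleave]
      simp [Ψ, hnxt e, hq, CubeComplex.stateData]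
  -- the vertices visited by the projected paths
  have hvisit : ∀ (es : List A.Edge) (q : A.State) (z : V) (x x' : Z.RestrictionVertex W)
      (R : (Z.restriction W).graph.Walk x x'), x = Z.proj W z → A.IsPath q es →
      dat q = Z.stateData W H o z → (Z.restriction W).word H R = es.map A.label →
      R.support.map ((Z.restriction W).vertexOrbit H) = (A.states q es).map Ξ := by
    intro es
    induction es with
    | nil =>
      rintro q z x x' R rfl - hq hR
      cases R with
      | nil =>
        rw [SimpleGraph.Walk.support_nil, FiniteAutomaton.states, List.map_cons, List.map_cons, hΞ q z hq,
          List.map_nil, List.map_nil]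
      | cons hxb R => simp at hR
    | cons e es ih =>
      rintro q z x x' R rfl ⟨rfl, hes⟩ hq hR
      cases R with
      | nil => simp at hR
      | @cons _ b _ hxb R =>
        rw [CubeComplex.word_cons, List.map_cons, List.cons.injEq] at hR
        obtain ⟨y, hy, hyd⟩ := hedge e z hq
        obtain ⟨hadj, hl, -⟩ := hy.1.exists_adj
        have hb : b = Z.proj W y := congrArg (fun d => d.snd)
          (hX_special.eq_of_label_eq (d := ⟨(_, b), hxb⟩) (e := ⟨(_, _), hadj⟩) rfl
            (hR.1.trans hl.symm))
        rw [SimpleGraph.Walk.support_cons, List.map_cons, ih _ y b x' R hb hes hyd hR.2, FiniteAutomaton.states,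
          List.map_cons, hΞ _ z hq]
  refine ⟨ι, hinj, hcorr, hfinX, A, hpruned, hfinal, ⟨C, hC, fun w _ => hcard w⟩, γ, ?_, ⟨?_, ?_⟩,
    Ψ, Ξ, ?_, ?_, fun w ω hω => ?_⟩
  · refine fun w δ => ⟨fun h => ?_, ?_⟩
    · exact hX_special.eq_of_word_eq δ.2 (γ w).2 (h.2.trans (hγword w).symm)
    · rintro rfl
      exact ⟨hγgeo w, hγword w⟩
  · intro w w' h
    obtain ⟨z, hz, hzw⟩ := hγend w
    obtain ⟨z', hz', hzw'⟩ := hγend w'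
    have h1 := CubeComplex.runs_normalStep_of_runs_liftedStep hz
    rw [hzw.trans (h.trans hzw'.symm)] at h1
    exact Subtype.ext
      (hX.word_unique hX_special hr h1 (CubeComplex.runs_normalStep_of_runs_liftedStep hz'))
  · intro x
    obtain ⟨w, z, hz, rfl⟩ := hsurj x
    refine ⟨⟨w, (hlang w).2 ⟨z, hz⟩⟩, ?_⟩
    obtain ⟨z', hz', h⟩ := hγend ⟨w, (hlang w).2 ⟨z, hz⟩⟩
    exact h.symm.trans (congrArg (Z.proj W) (hz'.unique hdet hz))
  · intro q t ht hmem
    rcases hn : nxt q with _ | s <;> simp only [Ψ, hn, Option.elim] at ht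
    · simp at ht
    · obtain ⟨d, rfl, hd⟩ := CubeComplex.notMem_of_mem_gateWord ht
      exact hd ((hrange d).1 hmem)
  · rintro w ω ⟨h1, h2, h3⟩
    obtain ⟨z', R, h4, h5, h6⟩ := hlift ω.2 ω.1 o h2 (hinit _ h1) _ (CubeComplex.IsShielded.nil o)
    refine ⟨⟨z', R⟩, fun δ => ⟨fun h => ?_, ?_⟩, ?_⟩
    · exact hZ_special.eq_of_word_eq δ.2 R (h.2.trans h5.symm)
    · rintro rfl
      exact ⟨h6.1, h5⟩
    · obtain ⟨z, hz, h⟩ := hγend w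
      rw [h3] at h4
      exact (congrArg (Z.proj W) (h4.unique hdet hz)).trans h
  · obtain ⟨h1, h2, h3⟩ := hω
    exact hvisit ω.2 ω.1 o _ _ (γ w).2 rfl h2 (hinit _ h1) ((hγword w).trans h3.symm)
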